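/- Let $(X,d)$ be a metric space with a Borel measure $\mu$ that is doubling: for some constant $C_0$, $\mu(B(x,2r))\le C_0\,\mu(B(x,r))<\infty$ for all $x\in X$, $r>0$. Let $\mathbb B$ be a (real or complex) Banach space whose elements are measurable functions on $X$ (modulo equality a.e.), stable under truncation $f\mapsto 1_A f$ by indicators of measurable sets $A$ and containing all simple functions supported on sets of finite measure. Let $\mathcal T=\{T_t\}_{t>0}$ be bounded linear operators on $\mathbb B$ with $T_s\circ T_t=T_{s+t}$ for all $s,t>0$, and assume that each $T_t$ is compatible with truncation to balls: for all $f\in\mathbb B$ and $x\in X$, $T_t(1_{B(x,R)}f)\to T_tf$ in measure on every ball as $R\to\infty$. For a ball $B=B(x,r)$ and $j\ge2$ put $C_j(B)=B(x,2^{j+1}r)\setminus B(x,2^jr)$, and write $\left(\operatorname{avg}_B|h|^q\right)^{1/q}=\left(\mu(B)^{-1}\int_B|h|^q\,d\mu\right)^{1/q}$, $\left(\operatorname{avg}_{C_j(B)}|h|^q\right)^{1/q}=\left(\mu(B(x,2^{j+1}r))^{-1}\int_{C_j(B)}|h|^q\,d\mu\right)^{1/q}$ (essential suprema if $q=\infty$),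 and $\Upsilon(s)=\max\{s,s^{-1}\}$. For $1\le p\le q\le\infty$ we write $T_t\in\mathcal O(L^p-L^q)$ if there are constants $\theta_1,\theta_2,c,C>0$ such that for all $t>0$, all balls $B$ of radius $r>0$, all $f\in\mathbb B\cap L^p(\mu)$ and all $j\ge2$, $$\Big(\operatorname{avg}_B|T_t(1_Bf)|^q\Big)^{1/q}\le C\,\Upsilon\big(r/\sqrt t\big)^{\theta_2}\Big(\operatorname{avg}_B|f|^p\Big)^{1/p},$$ $$\Big(\operatorname{avg}_B|T_t(1_{C_j(B)}f)|^q\Big)^{1/q}\le C\,2^{j\theta_1}\,\Upsilon\big(2^jr/\sqrt t\big)^{\theta_2}e^{-c4^jr^2/t}\Big(\operatorname{avg}_{C_j(B)}|f|^p\Big)^{1/p},$$ $$\Big(\operatorname{avg}_{C_j(B)}|T_t(1_Bf)|^q\Big)^{1/q}\le C\,2^{j\theta_1}\,\Upsilon\big(2^jr/\sqrt t\big)^{\theta_2}e^{-c4^jr^2/t}\Big(\operatorname{avg}_B|f|^p\Big)^{1/p}.$$ Let $\widetilde{\mathcal J}(\mathcal T)$ be the set of all $p\in[1,\infty]$ such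 that $\sup_{t>0}\|T_tf\|_{L^p(\mu)}\le C\|f\|_{L^p(\mu)}$ for some finite $C$ and all $f\in\mathbb B\cap L^p(\mu)$. For a nonempty $E\subseteq[1,\infty]$ put $\operatorname{Int}E=\{s\in\mathbb R:\inf E<s<\sup E\}$. Assume that $T_t\in\mathcal O(L^{\tilde p}-L^{\tilde q})$ for some $1\le\tilde p<\tilde q\le\infty$. Then there is a unique set $\mathcal J(\mathcal T)\subseteq[1,\infty]$ such that for all $p,q\in[1,\infty]$ with $p<q$, $$T_t\in\mathcal O(L^p-L^q)\iff p,q\in\mathcal J(\mathcal T).$$ Moreover $\mathcal J(\mathcal T)$ is an interval containing $[\tilde p,\tilde q]$, $\widetilde{\mathcal J}(\mathcal T)$ is an interval, $\mathcal J(\mathcal T)\subseteq\widetilde{\mathcal J}(\mathcal T)$, and $\operatorname{Int}\mathcal J(\mathcal T)=\operatorname{Int}\widetilde{\mathcal J}(\mathcal T)$. -/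

import Mathlib

open MeasureTheory Filter Topology
open scoped ENNReal NNReal

namespace OffDiagBalls

/-- The doubling condition: all balls have finite measure and
`μ (B(x, 2r)) ≤ C₀ μ (B(x, r))` for all centers `x` and radii `r > 0`. -/
def Doubling {X : Type*} [MetricSpace X] [MeasurableSpace X] (μ : Measure X) : Prop :=
  ∃ C₀ : ℝ≥0, ∀ (x : X) (r : ℝ), 0 < r →
    μ (Metric.ball x (2 * r)) ≤ C₀ * μ (Metric.ball x r) ∧ μ (Metric.ball x r) < ∞

/-- A realization of the Banach space `E` as a space of (classes modulo a.e. equality of)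
measurable functions on `X`, stable under truncation by indicator functions of measurable sets
and containing the indicator functions of the measurable sets of finite measure (hence all
simple functions supported on a set of finite measure). -/
structure FunctionSpace (𝕜 : Type*) [RCLike 𝕜] {X : Type*} [MeasurableSpace X] (μ : Measure X)
    (E : Type*) [NormedAddCommGroup E] [NormedSpace 𝕜 E] where
  /-- the measurable function given by an element of `E` -/
  toFn : E →ₗ[𝕜] (X →ₘ[μ] 𝕜)
  injective : Function.Injective toFn
  exists_trunc : ∀ (f : E) (A : Set X), MeasurableSet A →
    ∃ g : E, (toFn g : X → 𝕜) =ᵐ[μ] A.indicator (toFn f : X → 𝕜)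
  exists_indicator : ∀ A : Set X, MeasurableSet A → μ A < ∞ →
    ∃ g : E, (toFn g : X → 𝕜) =ᵐ[μ] A.indicator (fun _ => (1 : 𝕜))

section

variable {𝕜 : Type*} [RCLike 𝕜] {X : Type*} [MeasurableSpace X] {μ : Measure X}
  {E : Type*} [NormedAddCommGroup E] [NormedSpace 𝕜 E]

open Classical in
/-- The truncation `1_A f`, as an element of `E`, for measurable `A`
(and `0` if `A` is not measurable). -/
noncomputable def FunctionSpace.trunc (F : FunctionSpace 𝕜 μ E) (A : Set X) (f : E) : E :=
  if hA : MeasurableSet A then Classical.choose (F.exists_trunc f A hA) else 0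

theorem FunctionSpace.toFn_trunc (F : FunctionSpace 𝕜 μ E) {A : Set X} (hA : MeasurableSet A)
    (f : E) : (F.toFn (F.trunc A f) : X → 𝕜) =ᵐ[μ] A.indicator (F.toFn f : X → 𝕜) := by
  unfold FunctionSpace.trunc
  rw [dif_pos hA]
  exact Classical.choose_spec (F.exists_trunc f A hA)

/-- `(μ(S')⁻¹ ∫_S |h|^q dμ)^{1/q}` for `q < ∞`, and the essential supremum of `|h|` on `S`
for `q = ∞`: the `L^q` norm of `h` on `S`, normalized by the mass of `S'`. -/
noncomputable def avgNorm (μ : Measure X) (q : ℝ≥0∞) (S S' : Set X) (h : X → 𝕜) : ℝ≥0∞ :=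
  eLpNorm h q ((μ S')⁻¹ • μ.restrict S)

end

/-- The `L^q` average of `h` over the ball `B(x, r)`. -/
noncomputable def ballAvg {𝕜 : Type*} [RCLike 𝕜] {X : Type*} [MetricSpace X] [MeasurableSpace X]
    (μ : Measure X) (q : ℝ≥0∞) (x : X) (r : ℝ) (h : X → 𝕜) : ℝ≥0∞ :=
  avgNorm μ q (Metric.ball x r) (Metric.ball x r) h

/-- The dyadic annulus `C_j(B) = 2^{j+1} B \ 2^j B` of the ball `B = B(x, r)` (used for `j ≥ 2`). -/
def annulus {X : Type*} [MetricSpace X] (x : X) (r : ℝ) (j : ℕ) : Set X :=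
  Metric.ball x (2 ^ (j + 1) * r) \ Metric.ball x (2 ^ j * r)

/-- The `L^q` average of `h` over `C_j(B)`, normalized by the mass of `2^{j+1} B`. -/
noncomputable def annulusAvg {𝕜 : Type*} [RCLike 𝕜] {X : Type*} [MetricSpace X]
    [MeasurableSpace X] (μ : Measure X) (q : ℝ≥0∞) (x : X) (r : ℝ) (j : ℕ) (h : X → 𝕜) : ℝ≥0∞ :=
  avgNorm μ q (annulus x r j) (Metric.ball x (2 ^ (j + 1) * r)) h

/-- `max {s, s⁻¹}` for `s > 0`. -/
noncomputable def dec (s : ℝ) : ℝ := max s s⁻¹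

section

variable {𝕜 : Type*} [RCLike 𝕜] {X : Type*} [MetricSpace X] [MeasurableSpace X] {μ : Measure X}
  {E : Type*} [NormedAddCommGroup E] [NormedSpace 𝕜 E]

/-- `L^p(μ) - L^q(μ)` off-diagonal estimates on balls for the family `(T t)_{t > 0}`, tested on
the functions in `E ∩ L^p(μ)`. -/
def OffDiag (F : FunctionSpace 𝕜 μ E) (T : ℝ → E →L[𝕜] E) (p q : ℝ≥0∞) : Prop :=
  ∃ θ₁ θ₂ c C : ℝ, 0 < θ₁ ∧ 0 < θ₂ ∧ 0 < c ∧ 0 < C ∧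
    ∀ t : ℝ, 0 < t → ∀ (x : X) (r : ℝ), 0 < r → ∀ f : E, MemLp (F.toFn f) p μ →
      ballAvg μ q x r (F.toFn (T t (F.trunc (Metric.ball x r) f)))
          ≤ ENNReal.ofReal (C * dec (r / √t) ^ θ₂) * ballAvg μ p x r (F.toFn f) ∧
      ∀ j : ℕ, 2 ≤ j →
        ballAvg μ q x r (F.toFn (T t (F.trunc (annulus x r j) f)))
            ≤ ENNReal.ofReal (C * (2 ^ ((j : ℝ) * θ₁) * dec (2 ^ j * r / √t) ^ θ₂ *
                Real.exp (-(c * 4 ^ j * r ^ 2 / t)))) * annulusAvg μ p x r j (F.toFn f) ∧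
        annulusAvg μ q x r j (F.toFn (T t (F.trunc (Metric.ball x r) f)))
            ≤ ENNReal.ofReal (C * (2 ^ ((j : ℝ) * θ₁) * dec (2 ^ j * r / √t) ^ θ₂ *
                Real.exp (-(c * 4 ^ j * r ^ 2 / t)))) * ballAvg μ p x r (F.toFn f)

/-- The set of exponents `p ∈ [1, ∞]` such that `T t` is bounded on `L^p(μ)` (that is, for the
`L^p(μ)` norm on `E ∩ L^p(μ)`), uniformly in `t > 0`. -/
def boundedExponents (F : FunctionSpace 𝕜 μ E) (T : ℝ → E →L[𝕜] E) : Set ℝ≥0∞ :=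
  {p | 1 ≤ p ∧ ∃ C : ℝ≥0, ∀ t : ℝ, 0 < t → ∀ f : E, MemLp (F.toFn f) p μ →
    eLpNorm (F.toFn (T t f)) p μ ≤ C * eLpNorm (F.toFn f) p μ}

/-- The operator `S` is continuous along exhaustions by balls: `S (1_{B(x,R)} f) → S f` in
measure on every ball as `R → ∞`. -/
def BallContinuous (F : FunctionSpace 𝕜 μ E) (S : E →L[𝕜] E) : Prop :=
  ∀ (f : E) (x : X) (ρ : ℝ),
    TendstoInMeasure (μ.restrict (Metric.ball x ρ))
      (fun (R : ℝ) => (F.toFn (S (F.trunc (Metric.ball x R) f)) : X → 𝕜)) atTop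
      (F.toFn (S f) : X → 𝕜)

/-- `J ⊆ [1, ∞]`, and for `1 ≤ p < q ≤ ∞` the off-diagonal estimates `L^p - L^q` hold if and only
if `p` and `q` belong to `J`. -/
def CharacterizesOffDiag (F : FunctionSpace 𝕜 μ E) (T : ℝ → E →L[𝕜] E) (J : Set ℝ≥0∞) : Prop :=
  J ⊆ Set.Icc 1 ∞ ∧
    ∀ p q : ℝ≥0∞, 1 ≤ p → p < q → (OffDiag F T p q ↔ p ∈ J ∧ q ∈ J)

end

/-- For a nonempty `A ⊆ [1, ∞]`, the open interval `{t ∈ ℝ ; inf A < t < sup A}`; when `A` is an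
interval this is the interior of `A ∩ ℝ` in `ℝ`. -/
def openHull (A : Set ℝ≥0∞) : Set ℝ :=
  {t | sInf A < ENNReal.ofReal t ∧ ENNReal.ofReal t < sSup A}

end OffDiagBalls

/-!
Off-diagonal estimates on balls are equivalent to *local estimates* (`Loc`): for measurable subsets
`A₁`, `A₂` of a ball `B = B(x, r)`,
`‖T_t(1_{A₁} f)‖_{L^q(A₂)} ≤ C Υ(r/√t)^N μ(B)^{1/q - 1/p} ‖f‖_{L^p(A₁)}`, with an additional
Gaussian factor `exp(-c r²/t)` when `dist(A₁, A₂) ≥ δ r`, for every `δ > 0`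
(`OffDiag.loc`, `Loc.offDiag`). Passing to this form requires one covering by small balls; in
exchange it is stable under everything that follows.

* Hölder's inequality shrinks the range of exponents (`Loc.mono`).
* The semigroup property makes the estimates transitive (`Loc.trans`): `T_t(1_{A₁} f)` is cut into
  its parts on the double of the ball and on the dyadic annuli, and the Gaussian decay sums up the
  annuli.
* At scale `√t` the local estimates `L^p - L^p` add up over a maximal separated set to uniform
  boundedness on `L^p` (`Loc.mem_boundedExponents`); conversely uniform boundedness on `L^p` is a
  local estimate without decay (`locEst_of_mem_boundedExponents`).
* Local estimates interpolate, and interpolation against an estimate without decay keeps a fraction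
  of the decay (`Loc.interpolation`). Since `T_t` is not continuous for any `L^p` topology a priori,
  and the scalars may be real, the interpolation is done by hand: `f` is cut along its dyadic level
  sets, and on each of them the two estimates combine by the logarithmic convexity of the `L^q`
  norms (`FunctionSpace.interpolation`). This loses an arbitrarily small amount in the first
  exponent, which is harmless because the exponents satisfy `p < q` strictly.

The set of exponents is then found by an order argument (`exists_interval`). Let `J` be the union of
the intervals `[p, q]` with `p < q` for which the `L^p - L^q` estimates hold. Interpolation shows
that each exponent between two such intervals is interior to a third one, so the two can be joined
by a connectedness argument and transitivity; this gives the characterization of the estimates by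
`J`. Interpolation between the given estimate and an exponent `b` of uniform boundedness shows that
all exponents strictly between `b` and `p₀` belong to `J`, so that `J` and the set of exponents of
uniform boundedness have the same infimum and supremum, and the latter is an interval too.
-/

namespace OffDiagBalls

/-! ### Truncations -/

section

variable {𝕜 : Type*} [RCLike 𝕜] {X : Type*} [MeasurableSpace X] {μ : Measure X}
  {E : Type*} [NormedAddCommGroup E] [NormedSpace 𝕜 E]

namespace FunctionSpace

variable (F : FunctionSpace 𝕜 μ E)

theorem ext_ae {f g : E} (h : (F.toFn f : X → 𝕜) =ᵐ[μ] F.toFn g) : f = g :=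
  F.injective (AEEqFun.ext h)

theorem toFn_add (f g : E) : (F.toFn (f + g) : X → 𝕜) =ᵐ[μ] ⇑(F.toFn f) + ⇑(F.toFn g) := by
  rw [map_add]
  exact AEEqFun.coeFn_add _ _

theorem toFn_sub (f g : E) : (F.toFn (f - g) : X → 𝕜) =ᵐ[μ] ⇑(F.toFn f) - ⇑(F.toFn g) := by
  rw [map_sub]
  exact AEEqFun.coeFn_sub _ _

theorem aestronglyMeasurable_toFn (f : E) (ν : Measure X) :
    AEStronglyMeasurable (F.toFn f : X → 𝕜) ν :=
  (AEEqFun.stronglyMeasurable _).aestronglyMeasurable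

theorem trunc_trunc {A B : Set X} (hA : MeasurableSet A) (hB : MeasurableSet B) (f : E) :
    F.trunc A (F.trunc B f) = F.trunc (A ∩ B) f := by
  apply F.ext_ae
  filter_upwards [F.toFn_trunc hA (F.trunc B f), F.toFn_trunc hB f,
    F.toFn_trunc (hA.inter hB) f] with x h1 h2 h3
  rw [h1, h3, ← Set.indicator_indicator]
  by_cases hx : x ∈ A <;> simp [hx, h2]

theorem trunc_union {A B : Set X} (hA : MeasurableSet A) (hB : MeasurableSet B)
    (hAB : Disjoint A B) (f : E) : F.trunc (A ∪ B) f = F.trunc A f + F.trunc B f := by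
  apply F.ext_ae
  filter_upwards [F.toFn_trunc hA f, F.toFn_trunc hB f, F.toFn_trunc (hA.union hB) f,
    F.toFn_add (F.trunc A f) (F.trunc B f)] with x h1 h2 h3 h4
  rw [h3, h4, Set.indicator_union_of_disjoint hAB]
  simp [h1, h2]

theorem trunc_eq_zero {A : Set X} (hA : MeasurableSet A) {f : E}
    (h : (F.toFn f : X → 𝕜) =ᵐ[μ.restrict A] 0) : F.trunc A f = 0 := by
  apply F.ext_ae
  rw [Filter.EventuallyEq, ae_restrict_iff' hA] at h
  rw [map_zero]
  filter_upwards [F.toFn_trunc hA f, h, AEEqFun.coeFn_zero (μ := μ) (β := 𝕜)] with x h1 h2 h3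
  rw [h1, h3]
  by_cases hx : x ∈ A <;> simp [hx, h2]

theorem trunc_empty (f : E) : F.trunc ∅ f = 0 :=
  F.trunc_eq_zero MeasurableSet.empty (by simp [Filter.EventuallyEq])

theorem eLpNorm_trunc {A : Set X} (hA : MeasurableSet A) (f : E) (p : ℝ≥0∞) :
    eLpNorm (F.toFn (F.trunc A f)) p μ = eLpNorm (F.toFn f) p (μ.restrict A) := by
  rw [eLpNorm_congr_ae (F.toFn_trunc hA f), eLpNorm_indicator_eq_eLpNorm_restrict hA]

theorem eLpNorm_restrict_trunc {A B : Set X} (hA : MeasurableSet A) (hB : MeasurableSet B)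
    (f : E) (p : ℝ≥0∞) :
    eLpNorm (F.toFn (F.trunc A f)) p (μ.restrict B) = eLpNorm (F.toFn f) p (μ.restrict (B ∩ A)) := by
  rw [← F.eLpNorm_trunc hB, F.trunc_trunc hB hA, F.eLpNorm_trunc (hB.inter hA)]

theorem eLpNorm_toFn_add_le (f g : E) {p : ℝ≥0∞} (hp : 1 ≤ p) (A : Set X) :
    eLpNorm (F.toFn (f + g)) p (μ.restrict A)
      ≤ eLpNorm (F.toFn f) p (μ.restrict A) + eLpNorm (F.toFn g) p (μ.restrict A) := by
  rw [eLpNorm_congr_ae (ae_restrict_of_ae (F.toFn_add f g))]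
  exact eLpNorm_add_le (F.aestronglyMeasurable_toFn _ _) (F.aestronglyMeasurable_toFn _ _) hp

/-- If `S (g n) → S g` in measure on `A` and `S` is controlled on the first term and on the
increments of the sequence `g n`, then it is controlled at `g`. -/
theorem eLpNorm_le_add_tsum (S : E →L[𝕜] E) {A : Set X} {q : ℝ≥0∞} (hq : 1 ≤ q)
    {g : ℕ → E} {g' : E} {K₀ : ℝ≥0∞} {K : ℕ → ℝ≥0∞}
    (hlim : TendstoInMeasure (μ.restrict A) (fun n => (F.toFn (S (g n)) : X → 𝕜)) atTop
      (F.toFn (S g')))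
    (h₀ : eLpNorm (F.toFn (S (g 0))) q (μ.restrict A) ≤ K₀)
    (hK : ∀ n, eLpNorm (F.toFn (S (g (n + 1) - g n))) q (μ.restrict A) ≤ K n) :
    eLpNorm (F.toFn (S g')) q (μ.restrict A) ≤ K₀ + ∑' n, K n := by
  have hn : ∀ n, eLpNorm (F.toFn (S (g n))) q (μ.restrict A)
      ≤ K₀ + ∑ k ∈ Finset.range n, K k := by
    intro n
    induction n with
    | zero => simpa using h₀
    | succ n ih =>
      have e : S (g (n + 1)) = S (g n) + S (g (n + 1) - g n) := by rw [map_sub]; abel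
      rw [e, Finset.sum_range_succ, ← add_assoc]
      exact (F.eLpNorm_toFn_add_le _ _ hq A).trans (add_le_add ih (hK n))
  refine eLpNorm_le_of_tendstoInMeasure (Eventually.of_forall fun n => (hn n).trans ?_) hlim
    fun n => F.aestronglyMeasurable_toFn _ _
  gcongr
  exact ENNReal.sum_le_tsum _

end FunctionSpace

end

/-! ### Interpolation without complex analysis -/

theorem inv_ne_top_of_one_le {p : ℝ≥0∞} (hp : 1 ≤ p) : p⁻¹ ≠ ∞ :=
  ENNReal.inv_ne_top.2 (zero_lt_one.trans_le hp).ne'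

theorem inv_eq_ofReal {p : ℝ≥0∞} (hp : 1 ≤ p) : p⁻¹ = ENNReal.ofReal p.toReal⁻¹ := by
  rw [← ENNReal.toReal_inv, ENNReal.ofReal_toReal (inv_ne_top_of_one_le hp)]

section

variable {X : Type*} [MeasurableSpace X] {ν : Measure X} {G : Type*} [NormedAddCommGroup G]

theorem eLpNorm_norm_rpow_div (h : X → G) {q : ℝ≥0∞} {a : ℝ} (ha : 0 < a) :
    eLpNorm (fun x => ‖h x‖ ^ a) (q / ENNReal.ofReal a) ν = eLpNorm h q ν ^ a := by
  rw [eLpNorm_norm_rpow _ ha, ENNReal.div_mul_cancel (by simpa using ha) ENNReal.ofReal_ne_top]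

/-- Logarithmic convexity of the `L^q` norms in `1 / q`. -/
theorem eLpNorm_le_rpow_mul_rpow {h : X → G} (hh : AEStronglyMeasurable h ν)
    {q₀ q₁ s : ℝ≥0∞} (hq₀ : 1 ≤ q₀) (hq₁ : 1 ≤ q₁) (hs : 1 ≤ s) {τ : ℝ} (h0 : 0 < τ) (h1 : τ < 1)
    (hτ : s.toReal⁻¹ = (1 - τ) * q₀.toReal⁻¹ + τ * q₁.toReal⁻¹) :
    eLpNorm h s ν ≤ eLpNorm h q₀ ν ^ (1 - τ) * eLpNorm h q₁ ν ^ τ := by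
  have h1' : 0 < 1 - τ := by linarith
  have hH : ENNReal.HolderTriple (q₀ / ENNReal.ofReal (1 - τ)) (q₁ / ENNReal.ofReal τ) s := by
    constructor
    rw [ENNReal.inv_div (by simp) (by simp [h1]), ENNReal.inv_div (by simp) (by simp [h0]),
      ENNReal.div_eq_inv_mul, ENNReal.div_eq_inv_mul, inv_eq_ofReal hq₀, inv_eq_ofReal hq₁,
      inv_eq_ofReal hs, ← ENNReal.ofReal_mul (by positivity), ← ENNReal.ofReal_mul (by positivity),
      ← ENNReal.ofReal_add (by positivity) (by positivity), hτ]
    congr 1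
    ring
  rw [← eLpNorm_norm_rpow_div h h1', ← eLpNorm_norm_rpow_div h h0]
  have e : eLpNorm h s ν
      = eLpNorm ((fun x => ‖h x‖ ^ (1 - τ)) • (fun x => ‖h x‖ ^ τ)) s ν := by
    rw [← eLpNorm_norm]
    congr 1
    funext x
    rw [Pi.smul_apply', smul_eq_mul, ← Real.rpow_add_of_nonneg (norm_nonneg _) h1'.le h0.le]
    simp
  rw [e]
  exact eLpNorm_smul_le_mul_eLpNorm
    (hh.norm.aemeasurable.pow_const _).aestronglyMeasurable
    (hh.norm.aemeasurable.pow_const _).aestronglyMeasurable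

/-- The `L^p` norm of `|h|^{r/p}`. For `p = ∞` the exponent is `0` and the norm is at most `1`. -/
theorem eLpNorm_norm_rpow_le (h : X → G) {p r : ℝ≥0∞} (hp : 1 ≤ p) (hr : 1 ≤ r) (hr' : r ≠ ∞) :
    eLpNorm (fun x => ‖h x‖ ^ (r.toReal * p.toReal⁻¹)) p ν
      ≤ eLpNorm h r ν ^ (r.toReal * p.toReal⁻¹) := by
  have hr0 : 0 < r.toReal := ENNReal.toReal_pos (zero_lt_one.trans_le hr).ne' hr'
  rcases eq_or_ne p ∞ with rfl | hp'
  · simp only [ENNReal.toReal_top, inv_zero, mul_zero, Real.rpow_zero, ENNReal.rpow_zero]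
    refine (eLpNorm_le_of_ae_bound (C := 1) (by simp)).trans ?_
    simp
  · have hp0 : 0 < p.toReal := ENNReal.toReal_pos (zero_lt_one.trans_le hp).ne' hp'
    rw [eLpNorm_norm_rpow _ (by positivity)]
    apply le_of_eq
    congr 2
    rw [← ENNReal.ofReal_toReal hp', ← ENNReal.ofReal_mul (by positivity),
      ENNReal.toReal_ofReal (by positivity), mul_comm, mul_assoc, inv_mul_cancel₀ hp0.ne', mul_one,
      ENNReal.ofReal_toReal hr']

end

section

variable {X : Type*} [MeasurableSpace X] {ν : Measure X} {G : Type*} [NormedAddCommGroup G]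

/-- If `|h| ≤ b |h|^{r/p}` on a set, then the `L^p` norm of `h` there is controlled by its `L^r`
norm. -/
theorem eLpNorm_le_mul_rpow_of_bound {h : X → G} {A D : Set X} (hD : MeasurableSet D)
    (hDA : D ⊆ A) {p r : ℝ≥0∞} (hp : 1 ≤ p) (hr : 1 ≤ r) (hr' : r ≠ ∞) {b : ℝ} (hb : 0 ≤ b)
    (hbound : ∀ x ∈ D, ‖h x‖ ≤ b * ‖h x‖ ^ (r.toReal * p.toReal⁻¹)) :
    eLpNorm h p (ν.restrict D)
      ≤ ENNReal.ofReal b * eLpNorm h r (ν.restrict A) ^ (r.toReal * p.toReal⁻¹) := by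
  have h1 : eLpNorm h p (ν.restrict D)
      ≤ eLpNorm (fun x => b * ‖h x‖ ^ (r.toReal * p.toReal⁻¹)) p (ν.restrict D) := by
    refine eLpNorm_mono_ae ((ae_restrict_iff' hD).2 (Eventually.of_forall fun x hx => ?_))
    exact (hbound x hx).trans (le_abs_self _)
  have h2 : eLpNorm (fun x => b * ‖h x‖ ^ (r.toReal * p.toReal⁻¹)) p (ν.restrict D)
      = ENNReal.ofReal b
        * eLpNorm (fun x => ‖h x‖ ^ (r.toReal * p.toReal⁻¹)) p (ν.restrict D) := by
    have := eLpNorm_const_smul b (fun x => ‖h x‖ ^ (r.toReal * p.toReal⁻¹)) p (ν.restrict D)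
    rw [Real.enorm_eq_ofReal hb] at this
    exact this
  refine h1.trans (h2.le.trans ?_)
  gcongr
  refine (eLpNorm_mono_measure _ (Measure.restrict_mono hDA le_rfl)).trans ?_
  exact eLpNorm_norm_rpow_le h hp hr hr'

/-- The part of a function on a dyadic level set. No order between `p` and `r` is needed. -/
theorem eLpNorm_level_le {h : X → G} {A : Set X} {L : ℝ} (hL : 0 < L)
    (hD : MeasurableSet (A ∩ {x | L < ‖h x‖ ∧ ‖h x‖ ≤ 2 * L})) {p r : ℝ≥0∞} (hp : 1 ≤ p)
    (hr : 1 ≤ r) (hr' : r ≠ ∞) :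
    eLpNorm h p (ν.restrict (A ∩ {x | L < ‖h x‖ ∧ ‖h x‖ ≤ 2 * L}))
      ≤ ENNReal.ofReal (2 * L ^ (1 - r.toReal * p.toReal⁻¹))
        * eLpNorm h r (ν.restrict A) ^ (r.toReal * p.toReal⁻¹) := by
  refine eLpNorm_le_mul_rpow_of_bound hD Set.inter_subset_left hp hr hr' (by positivity) ?_
  rintro x ⟨-, hx1, hx2⟩
  set β := r.toReal * p.toReal⁻¹ with hβ
  have hβ0 : 0 ≤ β := by positivity
  have hx0 : 0 < ‖h x‖ := hL.trans hx1
  have e : ‖h x‖ = ‖h x‖ ^ (1 - β) * ‖h x‖ ^ β := by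
    rw [← Real.rpow_add hx0]; simp
  have key : ‖h x‖ ^ (1 - β) ≤ 2 * L ^ (1 - β) := by
    rcases le_total β 1 with h | h
    · calc ‖_‖ ^ (1 - β) ≤ (2 * L) ^ (1 - β) := by
            apply Real.rpow_le_rpow hx0.le hx2; linarith
        _ = 2 ^ (1 - β) * L ^ (1 - β) := Real.mul_rpow (by norm_num) hL.le
        _ ≤ 2 ^ (1 : ℝ) * L ^ (1 - β) := by
            gcongr
            · norm_num
            · linarith
        _ = _ := by simp
    · calc ‖_‖ ^ (1 - β) ≤ L ^ (1 - β) :=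
            Real.rpow_le_rpow_of_nonpos hL hx1.le (by linarith)
        _ ≤ _ := by nlinarith [Real.rpow_pos_of_pos hL (1 - β)]
  calc ‖h x‖ = ‖h x‖ ^ (1 - β) * ‖h x‖ ^ β := e
    _ ≤ _ := by gcongr

/-- The part of a function above the height `L`; its `L^p` norm tends to zero as `L → ∞` if
`p < r`. -/
theorem eLpNorm_high_le {h : X → G} {A : Set X} {L : ℝ} (hL : 0 < L)
    (hD : MeasurableSet (A ∩ {x | L < ‖h x‖})) {p r : ℝ≥0∞} (hp : 1 ≤ p)
    (hr : 1 ≤ r) (hr' : r ≠ ∞) (hpr : 1 ≤ r.toReal * p.toReal⁻¹) :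
    eLpNorm h p (ν.restrict (A ∩ {x | L < ‖h x‖}))
      ≤ ENNReal.ofReal (L ^ (1 - r.toReal * p.toReal⁻¹))
        * eLpNorm h r (ν.restrict A) ^ (r.toReal * p.toReal⁻¹) := by
  refine eLpNorm_le_mul_rpow_of_bound hD Set.inter_subset_left hp hr hr' (by positivity) ?_
  rintro x ⟨-, hx1⟩
  set β := r.toReal * p.toReal⁻¹ with hβ
  have hx0 : 0 < ‖h x‖ := hL.trans hx1
  have e : ‖h x‖ = ‖h x‖ ^ (1 - β) * ‖h x‖ ^ β := by
    rw [← Real.rpow_add hx0]; simp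
  calc ‖h x‖ = ‖h x‖ ^ (1 - β) * ‖h x‖ ^ β := e
    _ ≤ _ := by
      gcongr ?_ * _
      exact Real.rpow_le_rpow_of_nonpos hL (le_of_lt hx1) (by linarith)

/-- The part of a function below the height `L`, on a set of mass at most `V`. -/
theorem eLpNorm_low_le {h : X → G} {A : Set X} {L V : ℝ} (hV : 0 ≤ V)
    (hAV : ν A ≤ ENNReal.ofReal V)
    (hD : MeasurableSet (A ∩ {x | ‖h x‖ ≤ L})) {p : ℝ≥0∞} :
    eLpNorm h p (ν.restrict (A ∩ {x | ‖h x‖ ≤ L})) ≤ ENNReal.ofReal (V ^ p.toReal⁻¹ * L) := by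
  have h0 : 0 ≤ p.toReal⁻¹ := by positivity
  refine (eLpNorm_le_of_ae_bound (C := L)
    ((ae_restrict_iff' hD).2 (Eventually.of_forall fun x hx => hx.2))).trans ?_
  rw [ENNReal.ofReal_mul (by positivity), ← ENNReal.ofReal_rpow_of_nonneg hV h0]
  gcongr
  rw [Measure.restrict_apply_univ]
  exact (measure_mono Set.inter_subset_left).trans hAV

end

section

variable {𝕜 : Type*} [RCLike 𝕜] {X : Type*} [MeasurableSpace X] {μ : Measure X}
  {E : Type*} [NormedAddCommGroup E] [NormedSpace 𝕜 E]

namespace FunctionSpace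

variable (F : FunctionSpace 𝕜 μ E)

theorem measurable_norm_toFn (f : E) : Measurable fun x => ‖(F.toFn f : X → 𝕜) x‖ :=
  (AEEqFun.stronglyMeasurable _).measurable.norm

/-- Bounds for `S g` at two exponents, combined by logarithmic convexity. -/
theorem eLpNorm_apply_le_of_endpoints (S : E →L[𝕜] E) {A₂ : Set X} {q₀ q₁ s : ℝ≥0∞}
    (hq₀ : 1 ≤ q₀) (hq₁ : 1 ≤ q₁) (hs : 1 ≤ s) {τ : ℝ} (h0 : 0 < τ) (h1 : τ < 1)
    (hτ : s.toReal⁻¹ = (1 - τ) * q₀.toReal⁻¹ + τ * q₁.toReal⁻¹)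
    {M₀ M₁ : ℝ} (hM₀ : 0 < M₀) (hM₁ : 0 < M₁) {b₀ b₁ : ℝ}
    (hb₀ : 0 ≤ b₀) (hb₁ : 0 ≤ b₁) {g : E}
    (hg₀ : eLpNorm (F.toFn (S g)) q₀ (μ.restrict A₂) ≤ ENNReal.ofReal (M₀ * b₀))
    (hg₁ : eLpNorm (F.toFn (S g)) q₁ (μ.restrict A₂) ≤ ENNReal.ofReal (M₁ * b₁)) :
    eLpNorm (F.toFn (S g)) s (μ.restrict A₂)
      ≤ ENNReal.ofReal ((M₀ ^ (1 - τ) * M₁ ^ τ) * (b₀ ^ (1 - τ) * b₁ ^ τ)) := by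
  have h1' : 0 ≤ 1 - τ := by linarith
  refine (eLpNorm_le_rpow_mul_rpow (F.aestronglyMeasurable_toFn _ _) hq₀ hq₁ hs h0 h1 hτ).trans ?_
  calc _ ≤ ENNReal.ofReal (M₀ * b₀) ^ (1 - τ) * ENNReal.ofReal (M₁ * b₁) ^ τ := by gcongr
    _ = ENNReal.ofReal ((M₀ * b₀) ^ (1 - τ) * (M₁ * b₁) ^ τ) := by
      rw [ENNReal.ofReal_rpow_of_nonneg (by positivity) h1',
        ENNReal.ofReal_rpow_of_nonneg (by positivity) h0.le, ENNReal.ofReal_mul (by positivity)]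
    _ = _ := by
      rw [Real.mul_rpow hM₀.le hb₀, Real.mul_rpow hM₁.le hb₁]
      congr 1
      ring

/-- Interpolation with a loss in the first exponent: bounds `L^{p₀} → L^{q₀}` and
`L^{p₁} → L^{q₁}` from `A₁` to `A₂` give the bound `L^r → L^s` at the intermediate exponent `s`
for every `r` strictly above the intermediate exponent of `p₀` and `p₁`. The function is cut along
its dyadic level sets; on each of them the two bounds combine by the logarithmic convexity of the
`L^q` norms, and the loss makes the resulting series geometric. -/
theorem interpolation (S : E →L[𝕜] E) {A₁ A₂ : Set X} (hA₁ : MeasurableSet A₁)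
    {p₀ p₁ q₀ q₁ r s : ℝ≥0∞} (hp₀ : 1 ≤ p₀) (hp₁ : 1 ≤ p₁)
    (hq₀ : 1 ≤ q₀) (hq₁ : 1 ≤ q₁) (hs : 1 ≤ s) (hr : 1 ≤ r) (hr' : r ≠ ∞)
    {τ : ℝ} (h0 : 0 < τ) (h1 : τ < 1)
    (hτ : s.toReal⁻¹ = (1 - τ) * q₀.toReal⁻¹ + τ * q₁.toReal⁻¹)
    (hloss : 1 < r.toReal * ((1 - τ) * p₀.toReal⁻¹ + τ * p₁.toReal⁻¹))
    {V : ℝ} (hV : 0 < V) (hAV : μ A₁ ≤ ENNReal.ofReal V)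
    {M₀ M₁ : ℝ} (hM₀ : 0 < M₀) (hM₁ : 0 < M₁)
    (hS₀ : ∀ f, eLpNorm (F.toFn (S (F.trunc A₁ f))) q₀ (μ.restrict A₂)
      ≤ ENNReal.ofReal M₀ * eLpNorm (F.toFn f) p₀ (μ.restrict A₁))
    (hS₁ : ∀ f, eLpNorm (F.toFn (S (F.trunc A₁ f))) q₁ (μ.restrict A₂)
      ≤ ENNReal.ofReal M₁ * eLpNorm (F.toFn f) p₁ (μ.restrict A₁)) (f : E) :
    eLpNorm (F.toFn (S (F.trunc A₁ f))) s (μ.restrict A₂)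
      ≤ ENNReal.ofReal ((1 + 2 * (1 - 2 ^ (1 - r.toReal *
            ((1 - τ) * p₀.toReal⁻¹ + τ * p₁.toReal⁻¹)))⁻¹) * (M₀ ^ (1 - τ) * M₁ ^ τ)
            * V ^ ((1 - τ) * p₀.toReal⁻¹ + τ * p₁.toReal⁻¹ - r.toReal⁻¹))
        * eLpNorm (F.toFn f) r (μ.restrict A₁) := by
  have hr0 : 0 < r.toReal := ENNReal.toReal_pos (zero_lt_one.trans_le hr).ne' hr'
  have h1' : 0 < 1 - τ := by linarith
  have hS : ∀ {p q : ℝ≥0∞} {M : ℝ}, (∀ f, eLpNorm (F.toFn (S (F.trunc A₁ f))) q (μ.restrict A₂)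
      ≤ ENNReal.ofReal M * eLpNorm (F.toFn f) p (μ.restrict A₁)) → ∀ D, MeasurableSet D → D ⊆ A₁ →
      eLpNorm (F.toFn (S (F.trunc D f))) q (μ.restrict A₂)
        ≤ ENNReal.ofReal M * eLpNorm (F.toFn f) p (μ.restrict D) := by
    intro p q M h D hD hDA
    have := h (F.trunc D f)
    rwa [F.trunc_trunc hA₁ hD, F.eLpNorm_restrict_trunc hD hA₁,
      Set.inter_eq_self_of_subset_right hDA] at this
  set α := (1 - τ) * p₀.toReal⁻¹ + τ * p₁.toReal⁻¹ with hα
  set ρ : ℝ := 2 ^ (1 - r.toReal * α) with hρ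
  have hρ0 : 0 < ρ := by positivity
  have hρ1 : ρ < 1 := Real.rpow_lt_one_of_one_lt_of_neg (by norm_num) (by linarith)
  have hρ1' : 0 < (1 - ρ)⁻¹ := inv_pos.2 (by linarith)
  have hM : 0 < M₀ ^ (1 - τ) * M₁ ^ τ := by positivity
  rcases eq_or_ne (eLpNorm (F.toFn f) r (μ.restrict A₁)) 0 with hl0 | hl0
  · rw [eLpNorm_eq_zero_iff (F.aestronglyMeasurable_toFn _ _) (zero_lt_one.trans_le hr).ne'] at hl0
    rw [F.trunc_eq_zero hA₁ hl0, map_zero, map_zero, eLpNorm_congr_ae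
      (ae_restrict_of_ae (AEEqFun.coeFn_zero (μ := μ) (β := 𝕜)))]
    simp
  rcases eq_or_ne (eLpNorm (F.toFn f) r (μ.restrict A₁)) ∞ with hltop | hltop
  · rw [hltop, ENNReal.mul_top]
    · exact le_top
    · have : 0 < V ^ (α - r.toReal⁻¹) := by positivity
      simp only [ne_eq, ENNReal.ofReal_eq_zero, not_le]
      positivity
  obtain ⟨l, hl, hlf⟩ : ∃ l : ℝ, 0 < l ∧
      eLpNorm (F.toFn f) r (μ.restrict A₁) = ENNReal.ofReal l :=
    ⟨_, ENNReal.toReal_pos hl0 hltop, (ENNReal.ofReal_toReal hltop).symm⟩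
  -- the height at which the function, normalized by the total mass, has unit size
  set L : ℕ → ℝ := fun n => 2 ^ n * (l * V ^ (-r.toReal⁻¹)) with hLdef
  have hL : ∀ n, 0 < L n := fun n => by positivity
  have hLs : ∀ n, L (n + 1) = 2 * L n := fun n => by simp only [hLdef]; ring
  have hlogl : ∀ y : ℝ, Real.log (l * V ^ y) = Real.log l + y * Real.log V := fun y => by
    rw [Real.log_mul hl.ne' (by positivity), Real.log_rpow hV]
  have hmeas := F.measurable_norm_toFn f
  have hlow : ∀ n, MeasurableSet (A₁ ∩ {x | ‖(F.toFn f : X → 𝕜) x‖ ≤ L n}) := fun n =>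
    hA₁.inter (measurableSet_le hmeas measurable_const)
  have hhigh : ∀ n, MeasurableSet (A₁ ∩ {x | L n < ‖(F.toFn f : X → 𝕜) x‖}) := fun n =>
    hA₁.inter (measurableSet_lt measurable_const hmeas)
  have hlev : ∀ n, MeasurableSet
      (A₁ ∩ {x | L n < ‖(F.toFn f : X → 𝕜) x‖ ∧ ‖(F.toFn f : X → 𝕜) x‖ ≤ 2 * L n}) := fun n =>
    hA₁.inter ((measurableSet_lt measurable_const hmeas).inter
      (measurableSet_le hmeas measurable_const))
  set g : ℕ → E := fun n => F.trunc (A₁ ∩ {x | ‖(F.toFn f : X → 𝕜) x‖ ≤ L n}) f with hg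
  have hstep : ∀ n, g (n + 1) - g n = F.trunc
      (A₁ ∩ {x | L n < ‖(F.toFn f : X → 𝕜) x‖ ∧ ‖(F.toFn f : X → 𝕜) x‖ ≤ 2 * L n}) f := by
    intro n
    rw [sub_eq_iff_eq_add']
    simp only [hg]
    rw [← F.trunc_union (hlow n) (hlev n)]
    · congr 1
      ext x
      have := hL n
      simp only [hLs, Set.mem_inter_iff, Set.mem_ofPred_eq, Set.mem_union]
      constructor
      · rintro ⟨h1, h2⟩
        rcases le_or_gt (‖(F.toFn f : X → 𝕜) x‖) (L n) with h | h
        · exact Or.inl ⟨h1, h⟩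
        · exact Or.inr ⟨h1, h, h2⟩
      · rintro (⟨h1, h2⟩ | ⟨h1, -, h2⟩)
        · exact ⟨h1, by linarith⟩
        · exact ⟨h1, h2⟩
    · rw [Set.disjoint_left]
      rintro x ⟨-, h1⟩ ⟨-, h2, -⟩
      exact (not_le.2 h2) h1
  have htail : ∀ n, F.trunc A₁ f - g n = F.trunc
      (A₁ ∩ {x | L n < ‖(F.toFn f : X → 𝕜) x‖}) f := by
    intro n
    rw [sub_eq_iff_eq_add']
    simp only [hg]
    rw [← F.trunc_union (hlow n) (hhigh n)]
    · congr 1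
      ext x
      simp only [Set.mem_inter_iff, Set.mem_ofPred_eq, Set.mem_union]
      constructor
      · intro h1
        rcases le_or_gt (‖(F.toFn f : X → 𝕜) x‖) (L n) with h | h
        · exact Or.inl ⟨h1, h⟩
        · exact Or.inr ⟨h1, h⟩
      · rintro (⟨h1, -⟩ | ⟨h1, -⟩) <;> exact h1
    · rw [Set.disjoint_left]
      rintro x ⟨-, h1⟩ ⟨-, h2⟩
      simp only [Set.mem_ofPred_eq] at h1 h2
      linarith
  have hlim : ∀ {p q : ℝ≥0∞} {M : ℝ}, 1 ≤ p → 1 ≤ q →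
      (∀ f, eLpNorm (F.toFn (S (F.trunc A₁ f))) q (μ.restrict A₂)
        ≤ ENNReal.ofReal M * eLpNorm (F.toFn f) p (μ.restrict A₁)) → 1 < r.toReal * p.toReal⁻¹ →
      TendstoInMeasure (μ.restrict A₂) (fun n => (F.toFn (S (g n)) : X → 𝕜)) atTop
        (F.toFn (S (F.trunc A₁ f))) := by
    intro p q M hp hq h hpr
    refine tendstoInMeasure_of_tendsto_eLpNorm (zero_lt_one.trans_le hq).ne'
      (fun n => F.aestronglyMeasurable_toFn _ _) (F.aestronglyMeasurable_toFn _ _) ?_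
    have hLn : Tendsto L atTop atTop :=
      (tendsto_pow_atTop_atTop_of_one_lt (by norm_num)).atTop_mul_const (by positivity)
    have h2 : Tendsto (fun n => ENNReal.ofReal M *
        (ENNReal.ofReal (L n ^ (1 - r.toReal * p.toReal⁻¹))
          * ENNReal.ofReal l ^ (r.toReal * p.toReal⁻¹))) atTop (𝓝 0) := by
      have h3 : Tendsto (fun n => L n ^ (1 - r.toReal * p.toReal⁻¹)) atTop (𝓝 0) := by
        have := (tendsto_rpow_neg_atTop (y := r.toReal * p.toReal⁻¹ - 1) (by linarith)).comp hLn
        simpa [Function.comp_def] using this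
      have h4 := ENNReal.tendsto_ofReal h3
      rw [ENNReal.ofReal_zero] at h4
      have h5 := ENNReal.Tendsto.mul_const (b := ENNReal.ofReal l ^ (r.toReal * p.toReal⁻¹)) h4
        (Or.inr (ENNReal.rpow_ne_top_of_nonneg (by positivity) ENNReal.ofReal_ne_top))
      have h6 := ENNReal.Tendsto.const_mul (a := ENNReal.ofReal M) h5
        (Or.inr ENNReal.ofReal_ne_top)
      simpa using h6
    refine tendsto_of_tendsto_of_tendsto_of_le_of_le tendsto_const_nhds h2
      (fun n => zero_le) fun n => ?_
    change eLpNorm (⇑(F.toFn (S (g n))) - ⇑(F.toFn (S (F.trunc A₁ f)))) q (μ.restrict A₂) ≤ _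
    rw [eLpNorm_sub_comm, ← eLpNorm_congr_ae (ae_restrict_of_ae (F.toFn_sub _ _)), ← map_sub,
      htail]
    refine (hS h _ (hhigh n) Set.inter_subset_left).trans ?_
    rw [← hlf]
    gcongr
    exact eLpNorm_high_le (hL n) (hhigh n) hp hr hr' hpr.le
  have hlim' : TendstoInMeasure (μ.restrict A₂) (fun n => (F.toFn (S (g n)) : X → 𝕜)) atTop
        (F.toFn (S (F.trunc A₁ f))) := by
    by_cases hc : 1 < r.toReal * p₀.toReal⁻¹
    · exact hlim hp₀ hq₀ hS₀ hc
    · refine hlim hp₁ hq₁ hS₁ ?_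
      by_contra hc'
      push Not at hc hc'
      have : r.toReal * α ≤ 1 := by
        rw [hα]
        nlinarith
      linarith
  set K : ℝ := M₀ ^ (1 - τ) * M₁ ^ τ * (l * V ^ (α - r.toReal⁻¹)) with hK
  have hK0 : 0 < K := by positivity
  have hbase : eLpNorm (F.toFn (S (g 0))) s (μ.restrict A₂) ≤ ENNReal.ofReal K := by
    have hb : ∀ {p q : ℝ≥0∞} {M : ℝ}, 0 < M →
        (∀ f, eLpNorm (F.toFn (S (F.trunc A₁ f))) q (μ.restrict A₂)
        ≤ ENNReal.ofReal M * eLpNorm (F.toFn f) p (μ.restrict A₁)) →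
        eLpNorm (F.toFn (S (g 0))) q (μ.restrict A₂)
          ≤ ENNReal.ofReal (M * (V ^ p.toReal⁻¹ * L 0)) := by
      intro p q M hM h
      refine (hS h _ (hlow 0) Set.inter_subset_left).trans ?_
      rw [ENNReal.ofReal_mul hM.le]
      gcongr
      exact eLpNorm_low_le hV.le hAV (hlow 0)
    refine (F.eLpNorm_apply_le_of_endpoints S hq₀ hq₁ hs h0 h1 hτ hM₀ hM₁
      (mul_pos (by positivity) (hL 0)).le (mul_pos (by positivity) (hL 0)).le
      (hb hM₀ hS₀) (hb hM₁ hS₁)).trans_eq ?_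
    rw [hK]
    congr 2
    have hL0 := hL 0
    have hlogL : Real.log (L 0) = Real.log l + -r.toReal⁻¹ * Real.log V := by
      rw [← hlogl]
      simp [hLdef]
    apply Real.log_injOn_pos (Set.mem_Ioi.2 (by positivity)) (Set.mem_Ioi.2 (by positivity))
    rw [Real.log_mul (by positivity) (by positivity), Real.log_rpow (by positivity),
      Real.log_rpow (by positivity), Real.log_mul (by positivity) hL0.ne',
      Real.log_mul (by positivity) hL0.ne', Real.log_rpow hV, Real.log_rpow hV, hlogL, hlogl, hα]
    ring
  have hterm : ∀ n, eLpNorm (F.toFn (S (g (n + 1) - g n))) s (μ.restrict A₂)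
      ≤ ENNReal.ofReal (2 * K * ρ ^ n) := by
    intro n
    have hb : ∀ {p q : ℝ≥0∞} {M : ℝ}, 1 ≤ p → 0 < M →
        (∀ f, eLpNorm (F.toFn (S (F.trunc A₁ f))) q (μ.restrict A₂)
        ≤ ENNReal.ofReal M * eLpNorm (F.toFn f) p (μ.restrict A₁)) →
        eLpNorm (F.toFn (S (g (n + 1) - g n))) q (μ.restrict A₂)
          ≤ ENNReal.ofReal (M * (2 * L n ^ (1 - r.toReal * p.toReal⁻¹)
            * l ^ (r.toReal * p.toReal⁻¹))) := by
      intro p q M hp hM h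
      have := hL n
      rw [hstep]
      refine (hS h _ (hlev n) Set.inter_subset_left).trans ?_
      rw [ENNReal.ofReal_mul hM.le]
      gcongr
      refine (eLpNorm_level_le (hL n) (hlev n) hp hr hr').trans_eq ?_
      rw [hlf, ENNReal.ofReal_rpow_of_nonneg hl.le (by positivity),
        ← ENNReal.ofReal_mul (by positivity)]
    have hLn := hL n
    refine (F.eLpNorm_apply_le_of_endpoints S hq₀ hq₁ hs h0 h1 hτ hM₀ hM₁
      (by positivity) (by positivity) (hb hp₀ hM₀ hS₀) (hb hp₁ hM₁ hS₁)).trans_eq ?_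
    have e : 2 * K * ρ ^ n
        = M₀ ^ (1 - τ) * M₁ ^ τ * (2 * (l * V ^ (α - r.toReal⁻¹)) * ρ ^ n) := by
      rw [hK]; ring
    rw [e]
    congr 2
    apply Real.log_injOn_pos (Set.mem_Ioi.2 (by positivity)) (Set.mem_Ioi.2 (by positivity))
    have hlogL : Real.log (L n) = n * Real.log 2 + (Real.log l + -r.toReal⁻¹ * Real.log V) := by
      rw [← hlogl, ← Real.log_pow, ← Real.log_mul (by positivity) (by positivity)]
    have hlogρ : Real.log (ρ ^ n) = n * ((1 - r.toReal * α) * Real.log 2) := by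
      rw [Real.log_pow, hρ, Real.log_rpow (by norm_num)]
    have hlogb : ∀ b : ℝ, Real.log (2 * L n ^ (1 - b) * l ^ b)
        = Real.log 2 + (1 - b) * Real.log (L n) + b * Real.log l := by
      intro b
      rw [Real.log_mul (by positivity) (by positivity),
        Real.log_mul (by positivity) (by positivity), Real.log_rpow hLn, Real.log_rpow hl]
    have hlogR : Real.log (2 * (l * V ^ (α - r.toReal⁻¹)) * ρ ^ n)
        = Real.log 2 + (Real.log l + (α - r.toReal⁻¹) * Real.log V)
          + n * ((1 - r.toReal * α) * Real.log 2) := by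
      rw [← hlogl, ← hlogρ, ← Real.log_mul (by positivity) (by positivity),
        ← Real.log_mul (by positivity) (by positivity)]
    rw [hlogR, Real.log_mul (by positivity) (by positivity), Real.log_rpow (by positivity),
      Real.log_rpow (by positivity), hlogb, hlogb, hlogL, hα]
    field_simp
    ring
  refine (F.eLpNorm_le_add_tsum S hs hlim' hbase hterm).trans ?_
  rw [← ENNReal.ofReal_tsum_of_nonneg (fun n => by positivity)
    ((summable_geometric_of_lt_one hρ0.le hρ1).mul_left _), tsum_mul_left,
    tsum_geometric_of_lt_one hρ0.le hρ1, ← ENNReal.ofReal_add hK0.le (by positivity), hlf,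
    ← ENNReal.ofReal_mul (by positivity)]
  apply ENNReal.ofReal_le_ofReal
  rw [hK]
  apply le_of_eq
  ring

end FunctionSpace

end

/-! ### The function `dec` -/

theorem one_le_dec {s : ℝ} (hs : 0 < s) : 1 ≤ dec s := by
  rcases le_total 1 s with h | h
  · exact h.trans (le_max_left _ _)
  · exact ((one_le_inv₀ hs).2 h).trans (le_max_right _ _)

theorem dec_mul_le {a s : ℝ} (ha : 0 < a) (hs : 0 < s) : dec (a * s) ≤ dec a * dec s := by
  refine max_le ?_ ?_
  · exact mul_le_mul (le_max_left _ _) (le_max_left _ _) hs.le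
      (zero_le_one.trans (one_le_dec ha))
  · rw [mul_inv]
    exact mul_le_mul (le_max_right _ _) (le_max_right _ _) (inv_nonneg.2 hs.le)
      (zero_le_one.trans (one_le_dec ha))

theorem dec_le_of_le {a b : ℝ} (h1 : a ≤ b) (h2 : a⁻¹ ≤ b) : dec a ≤ b := max_le h1 h2

theorem dec_two_pow_mul_le (n : ℕ) {s : ℝ} (hs : 0 < s) : dec (2 ^ n * s) ≤ 2 ^ n * dec s := by
  refine (dec_mul_le (by positivity) hs).trans ?_
  have : (1 : ℝ) ≤ 2 ^ n := one_le_pow₀ (by norm_num)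
  have h2 : 0 ≤ dec s := zero_le_one.trans (one_le_dec hs)
  gcongr
  exact dec_le_of_le le_rfl ((inv_le_one_of_one_le₀ this).trans this)

/-! ### Doubling measures -/

/-- Every set has a maximal `ε`-separated subset. -/
theorem exists_separated_net {X : Type*} [MetricSpace X] (S : Set X) (ε : ℝ) :
    ∃ Y ⊆ S, (∀ y ∈ Y, ∀ z ∈ Y, y ≠ z → ε ≤ dist y z) ∧ ∀ x ∈ S, x ∉ Y → ∃ y ∈ Y, dist x y < ε := by
  obtain ⟨Y, hY⟩ := zorn_subset
    {Y : Set X | Y ⊆ S ∧ ∀ y ∈ Y, ∀ z ∈ Y, y ≠ z → ε ≤ dist y z} (by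
      intro c hc hchain
      refine ⟨⋃₀ c, ⟨Set.sUnion_subset fun s hs => (hc hs).1, ?_⟩,
        fun s hs => Set.subset_sUnion_of_mem hs⟩
      rintro y ⟨s, hs, hys⟩ z ⟨u, hu, hzu⟩ hyz
      rcases hchain.total hs hu with h | h
      · exact (hc hu).2 y (h hys) z hzu hyz
      · exact (hc hs).2 y hys z (h hzu) hyz)
  refine ⟨Y, hY.prop.1, hY.prop.2, fun x hx hxY => ?_⟩
  by_contra! hfar
  refine hxY (hY.le_of_ge (y := insert x Y) ⟨Set.insert_subset hx hY.prop.1, ?_⟩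
    (Set.subset_insert _ _) (Set.mem_insert _ _))
  rintro y (rfl | hy) z (rfl | hz) hyz
  · exact absurd rfl hyz
  · exact hfar z hz
  · rw [dist_comm]; exact hfar y hy
  · exact hY.prop.2 y hy z hz hyz

section

variable {X : Type*} [MetricSpace X] [MeasurableSpace X]

/-- A doubling measure with constant `D` giving positive mass to every ball. This is what the
doubling condition says when the measure does not vanish. -/
structure IsDoublingWith (μ : Measure X) (D : ℝ) : Prop where
  one_le : 1 ≤ D
  pos : ∀ (x : X) (r : ℝ), 0 < r → 0 < μ (Metric.ball x r)
  lt_top : ∀ (x : X) (r : ℝ), μ (Metric.ball x r) < ∞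
  real_ball_le : ∀ (x : X) (r : ℝ), 0 < r →
    μ.real (Metric.ball x (2 * r)) ≤ D * μ.real (Metric.ball x r)

theorem Doubling.eq_zero_or {μ : Measure X} (h : Doubling μ) :
    μ = 0 ∨ ∃ D, IsDoublingWith μ D := by
  obtain ⟨C₀, hC⟩ := h
  by_cases hpos : ∀ (x : X) (r : ℝ), 0 < r → 0 < μ (Metric.ball x r)
  · have hfin : ∀ (x : X) (r : ℝ), μ (Metric.ball x r) < ∞ := by
      intro x r
      refine (measure_mono (Metric.ball_subset_ball (le_max_left r 1))).trans_lt
        (hC x (max r 1) (by positivity)).2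
    refine Or.inr ⟨max 1 C₀, le_max_left _ _, hpos, hfin, fun x r hr => ?_⟩
    have h1 := ENNReal.toReal_mono
      (ENNReal.mul_ne_top ENNReal.coe_ne_top (hfin x r).ne) (hC x r hr).1
    rw [ENNReal.toReal_mul, ENNReal.coe_toReal] at h1
    refine h1.trans ?_
    gcongr
    · exact le_max_right _ _
    · exact le_rfl
  · left
    push Not at hpos
    obtain ⟨x, r, hr, h0⟩ := hpos
    have h0' : ∀ n : ℕ, μ (Metric.ball x (2 ^ n * r)) = 0 := by
      intro n
      induction n with
      | zero => simpa using h0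
      | succ n ih =>
        have := (hC x (2 ^ n * r) (by positivity)).1
        rw [ih, mul_zero, ← mul_assoc, ← pow_succ'] at this
        exact le_antisymm this zero_le
    have hU : (⋃ n : ℕ, Metric.ball x (2 ^ n * r)) = Set.univ := by
      refine Set.eq_univ_of_forall fun y => Set.mem_iUnion.2 ?_
      obtain ⟨n, hn⟩ := pow_unbounded_of_one_lt (dist y x / r) (one_lt_two)
      exact ⟨n, by rwa [Metric.mem_ball, ← div_lt_iff₀ hr]⟩
    rw [← Measure.measure_univ_eq_zero, ← hU]
    exact measure_iUnion_null h0'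

namespace IsDoublingWith

variable {μ : Measure X} {D : ℝ} (hD : IsDoublingWith μ D)
include hD

theorem pos' : 0 < D := zero_lt_one.trans_le hD.one_le

theorem real_pos (x : X) {r : ℝ} (hr : 0 < r) : 0 < μ.real (Metric.ball x r) :=
  ENNReal.toReal_pos (hD.pos x r hr).ne' (hD.lt_top x r).ne

theorem ofReal_real (x : X) (r : ℝ) :
    ENNReal.ofReal (μ.real (Metric.ball x r)) = μ (Metric.ball x r) :=
  ENNReal.ofReal_toReal (hD.lt_top x r).ne

theorem real_mono {x y : X} {r s : ℝ} (h : dist x y + r ≤ s) :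
    μ.real (Metric.ball x r) ≤ μ.real (Metric.ball y s) :=
  ENNReal.toReal_mono (hD.lt_top y s).ne
    (measure_mono (Metric.ball_subset_ball' (by linarith)))

theorem real_ball_pow_le (x : X) {r : ℝ} (hr : 0 < r) (n : ℕ) :
    μ.real (Metric.ball x (2 ^ n * r)) ≤ D ^ n * μ.real (Metric.ball x r) := by
  induction n with
  | zero => simp
  | succ n ih =>
    have h1 := hD.real_ball_le x (2 ^ n * r) (by positivity)
    have h2 := hD.pos'
    rw [← mul_assoc, ← pow_succ'] at h1
    refine h1.trans ?_
    rw [pow_succ', mul_assoc]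
    gcongr

/-- A separated set inside a ball has boundedly many elements. -/
theorem card_le [OpensMeasurableSpace X] {ε : ℝ} (hε : 0 < ε) (x : X) (m : ℕ) (Y : Finset X)
    (hsep : ∀ y ∈ Y, ∀ z ∈ Y, y ≠ z → ε ≤ dist y z) (hY : ∀ y ∈ Y, dist y x < 2 ^ m * ε) :
    (Y.card : ℝ) ≤ D ^ (m + 3) := by
  have hm : (1 : ℝ) ≤ 2 ^ m := one_le_pow₀ (by norm_num)
  set R := 2 ^ m * ε + ε / 2 with hR
  have hR0 : 0 < R := by positivity
  have h1 : ∑ y ∈ Y, μ.real (Metric.ball y (ε / 2)) ≤ μ.real (Metric.ball x R) := by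
    have hdisj : (Y : Set X).PairwiseDisjoint fun y => Metric.ball y (ε / 2) :=
      fun y hy z hz hyz =>
        Metric.ball_disjoint_ball (by have := hsep y hy z hz hyz; linarith)
    rw [← measureReal_biUnion_finset hdisj (fun y _ => measurableSet_ball)
      (fun y _ => (hD.lt_top y _).ne)]
    refine measureReal_mono (Set.iUnion₂_subset fun y hy => ?_) (hD.lt_top x R).ne
    exact Metric.ball_subset_ball' (by have := hY y hy; rw [hR]; linarith)
  have h2 : ∀ y ∈ Y, μ.real (Metric.ball x R) ≤ D ^ (m + 3) * μ.real (Metric.ball y (ε / 2)) := by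
    intro y hy
    refine le_trans (hD.real_mono ?_) (hD.real_ball_pow_le y (half_pos hε) (m + 3))
    have := hY y hy
    rw [dist_comm] at this
    rw [hR, pow_add]
    nlinarith
  have h3 : (Y.card : ℝ) * μ.real (Metric.ball x R) ≤ D ^ (m + 3) * μ.real (Metric.ball x R) := by
    calc (Y.card : ℝ) * μ.real (Metric.ball x R) = ∑ y ∈ Y, μ.real (Metric.ball x R) := by simp
      _ ≤ ∑ y ∈ Y, D ^ (m + 3) * μ.real (Metric.ball y (ε / 2)) := Finset.sum_le_sum h2
      _ = D ^ (m + 3) * ∑ y ∈ Y, μ.real (Metric.ball y (ε / 2)) := by rw [Finset.mul_sum]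
      _ ≤ _ := by
        have := hD.pos'
        gcongr
  exact le_of_mul_le_mul_right h3 (hD.real_pos x hR0)

end IsDoublingWith

theorem IsDoublingWith.finite_of_separated [OpensMeasurableSpace X] {μ : Measure X} {D : ℝ}
    (hD : IsDoublingWith μ D)
    {ε : ℝ} (hε : 0 < ε) (x : X) (m : ℕ) {Y : Set X}
    (hsep : ∀ y ∈ Y, ∀ z ∈ Y, y ≠ z → ε ≤ dist y z) (hY : ∀ y ∈ Y, dist y x < 2 ^ m * ε) :
    Y.Finite := by
  by_contra hinf
  obtain ⟨n, hn⟩ := exists_nat_gt (D ^ (m + 3))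
  obtain ⟨Z, hZ, hcard⟩ := Set.Infinite.exists_subset_card_eq hinf n
  have := hD.card_le hε x m Z (fun y hy z hz => hsep y (hZ hy) z (hZ hz)) fun y hy => hY y (hZ hy)
  rw [hcard] at this
  linarith

end

/-! ### Local estimates -/

section

variable {X : Type*} [MeasurableSpace X] {μ : Measure X} {G : Type*} [NormedAddCommGroup G]

theorem eLpNorm_restrict_union_le {h : X → G} (hh : AEStronglyMeasurable h μ) {A B : Set X}
    (hA : MeasurableSet A) (hB : MeasurableSet B) {q : ℝ≥0∞} (hq : 1 ≤ q) :
    eLpNorm h q (μ.restrict (A ∪ B)) ≤ eLpNorm h q (μ.restrict A) + eLpNorm h q (μ.restrict B) := by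
  have e : A ∪ B = A ∪ (B \ A) := by simp
  rw [e, ← eLpNorm_indicator_eq_eLpNorm_restrict (hA.union (hB.diff hA)),
    Set.indicator_union_of_disjoint Set.disjoint_sdiff_right]
  refine (eLpNorm_add_le (hh.indicator hA) (hh.indicator (hB.diff hA)) hq).trans ?_
  rw [eLpNorm_indicator_eq_eLpNorm_restrict hA,
    eLpNorm_indicator_eq_eLpNorm_restrict (hB.diff hA)]
  gcongr
  exact Set.sdiff_subset

theorem eLpNorm_restrict_le_card_mul {h : X → G} (hh : AEStronglyMeasurable h μ)
    {ι : Type*} (J : Finset ι) {B : ι → Set X} (hB : ∀ j, MeasurableSet (B j)) {q K : ℝ≥0∞}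
    (hq : 1 ≤ q) (hK : ∀ j ∈ J, eLpNorm h q (μ.restrict (B j)) ≤ K) {A : Set X}
    (hA : A ⊆ ⋃ j ∈ J, B j) : eLpNorm h q (μ.restrict A) ≤ J.card * K := by
  refine (eLpNorm_mono_measure _ (Measure.restrict_mono hA le_rfl)).trans ?_
  clear hA
  induction J using Finset.cons_induction with
  | empty => simp
  | cons a s ha ih =>
    rw [Finset.card_cons, Nat.cast_add, Nat.cast_one, add_mul, one_mul, add_comm]
    have e : (⋃ j ∈ Finset.cons a s ha, B j) = B a ∪ ⋃ j ∈ s, B j := by simp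
    rw [e]
    refine (eLpNorm_restrict_union_le hh (hB a)
      (Finset.measurableSet_biUnion s fun j _ => hB j) hq).trans ?_
    exact add_le_add (hK a (by simp)) (ih fun j hj => hK j (by simp [hj]))

end

section

variable {𝕜 : Type*} [RCLike 𝕜] {X : Type*} [MetricSpace X] [MeasurableSpace X]
  {μ : Measure X} {E : Type*} [NormedAddCommGroup E] [NormedSpace 𝕜 E]

/-- Local `L^p - L^q` estimates between two measurable subsets `A₁`, `A₂` of a ball, whose
distance is at least `δ` times the radius, with Gaussian decay of rate `c`. The estimates
are normalized by the mass of the ball. The case `δ = c = 0` is an estimate without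
separation and without decay. -/
def LocEst (F : FunctionSpace 𝕜 μ E) (T : ℝ → E →L[𝕜] E) (p q : ℝ≥0∞) (δ c : ℝ) : Prop :=
  ∃ N C : ℝ, 0 ≤ N ∧ 0 < C ∧ ∀ t : ℝ, 0 < t → ∀ (x : X) (r : ℝ), 0 < r →
    ∀ A₁ A₂ : Set X, MeasurableSet A₁ → MeasurableSet A₂ → A₁ ⊆ Metric.ball x r →
      A₂ ⊆ Metric.ball x r → (∀ a ∈ A₁, ∀ b ∈ A₂, δ * r ≤ dist a b) → ∀ f : E,
        eLpNorm (F.toFn (T t (F.trunc A₁ f))) q (μ.restrict A₂)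
          ≤ ENNReal.ofReal (C * dec (r / √t) ^ N * Real.exp (-(c * (r / √t) ^ 2))
              * μ.real (Metric.ball x r) ^ (q.toReal⁻¹ - p.toReal⁻¹))
            * eLpNorm (F.toFn f) p (μ.restrict A₁)

/-- Local estimates on balls, with Gaussian decay between separated sets. -/
def Loc (F : FunctionSpace 𝕜 μ E) (T : ℝ → E →L[𝕜] E) (p q : ℝ≥0∞) : Prop :=
  LocEst F T p q 0 0 ∧ ∀ δ : ℝ, 0 < δ → ∃ c : ℝ, 0 < c ∧ LocEst F T p q δ c

variable {F : FunctionSpace 𝕜 μ E} {T : ℝ → E →L[𝕜] E} {p q : ℝ≥0∞} {D : ℝ}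

theorem toReal_inv_anti {p q : ℝ≥0∞} (hp : 1 ≤ p) (h : p ≤ q) : q.toReal⁻¹ ≤ p.toReal⁻¹ := by
  rw [← ENNReal.toReal_inv, ← ENNReal.toReal_inv]
  exact ENNReal.toReal_mono (inv_ne_top_of_one_le hp) (ENNReal.inv_le_inv.2 h)

theorem toReal_inv_le_one {p : ℝ≥0∞} (hp : 1 ≤ p) : p.toReal⁻¹ ≤ 1 := by
  simpa using toReal_inv_anti le_rfl hp

theorem eLpNorm_restrict_le_of_subset_ball {G : Type*} [NormedAddCommGroup G]
    (hD : IsDoublingWith μ D) {h : X → G} {A : Set X}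
    (hh : AEStronglyMeasurable h (μ.restrict A)) {x : X} {r : ℝ}
    (hA : A ⊆ Metric.ball x r) (hp : 1 ≤ p) (hpq : p ≤ q) :
    eLpNorm h p (μ.restrict A)
      ≤ ENNReal.ofReal (μ.real (Metric.ball x r) ^ (p.toReal⁻¹ - q.toReal⁻¹))
        * eLpNorm h q (μ.restrict A) := by
  have h0 : 0 ≤ p.toReal⁻¹ - q.toReal⁻¹ := sub_nonneg.2 (toReal_inv_anti hp hpq)
  refine (eLpNorm_le_eLpNorm_mul_rpow_measure_univ hpq hh).trans ?_
  rw [mul_comm, Measure.restrict_apply_univ, one_div, one_div,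
    ← ENNReal.ofReal_rpow_of_nonneg measureReal_nonneg h0, hD.ofReal_real]
  gcongr

/-- By Hölder's inequality the range of exponents can be shrunk from both sides. -/
theorem LocEst.mono (hD : IsDoublingWith μ D) {δ c : ℝ} (h : LocEst F T p q δ c) {p' q' : ℝ≥0∞}
    (hp : 1 ≤ p) (hpp : p ≤ p') (hpq : p' ≤ q') (hqq : q' ≤ q) : LocEst F T p' q' δ c := by
  obtain ⟨N, C, hN, hC, H⟩ := h
  refine ⟨N, C, hN, hC, fun t ht x r hr A₁ A₂ hA₁ hA₂ h₁ h₂ hsep f => ?_⟩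
  have hV := hD.real_pos x hr
  refine (eLpNorm_restrict_le_of_subset_ball hD (F.aestronglyMeasurable_toFn _ _) h₂
    (hp.trans (hpp.trans hpq)) hqq).trans ?_
  refine (mul_le_mul_right (H t ht x r hr A₁ A₂ hA₁ hA₂ h₁ h₂ hsep f) _).trans ?_
  refine (mul_le_mul_right (mul_le_mul_right (eLpNorm_restrict_le_of_subset_ball hD
    (F.aestronglyMeasurable_toFn f _) h₁ hp hpp) _) _).trans ?_
  have hdec : 0 ≤ dec (r / √t) :=
    zero_le_one.trans (one_le_dec (div_pos hr (Real.sqrt_pos.2 ht)))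
  rw [← mul_assoc, ← mul_assoc, ← ENNReal.ofReal_mul (by positivity),
    ← ENNReal.ofReal_mul (by positivity)]
  gcongr ENNReal.ofReal ?_ * _
  have e : q'.toReal⁻¹ - p'.toReal⁻¹
      = (q'.toReal⁻¹ - q.toReal⁻¹) + (q.toReal⁻¹ - p.toReal⁻¹) + (p.toReal⁻¹ - p'.toReal⁻¹) := by
    ring
  rw [e, Real.rpow_add hV, Real.rpow_add hV]
  apply le_of_eq
  ring

theorem Loc.mono (hD : IsDoublingWith μ D) (h : Loc F T p q) {p' q' : ℝ≥0∞}
    (hp : 1 ≤ p) (hpp : p ≤ p') (hpq : p' ≤ q') (hqq : q' ≤ q) : Loc F T p' q' := by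
  refine ⟨h.1.mono hD hp hpp hpq hqq, fun δ hδ => ?_⟩
  obtain ⟨c, hc, hl⟩ := h.2 δ hδ
  exact ⟨c, hc, hl.mono hD hp hpp hpq hqq⟩

end

/-! ### Off-diagonal estimates on balls and local estimates -/

theorem rpow_le_mul_rpow_of_le {a b k e : ℝ} (ha : 0 ≤ a) (hb : 0 ≤ b) (hk : 1 ≤ k)
    (h : a ≤ k * b) (he : 0 ≤ e) (he' : e ≤ 1) : a ^ e ≤ k * b ^ e := by
  calc a ^ e ≤ (k * b) ^ e := by gcongr
    _ = k ^ e * b ^ e := Real.mul_rpow (by linarith) hb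
    _ ≤ k ^ (1 : ℝ) * b ^ e := by gcongr
    _ = _ := by rw [Real.rpow_one]

theorem mem_annulus {X : Type*} [MetricSpace X] {x y : X} {r : ℝ} {j : ℕ} :
    y ∈ annulus x r j ↔ 2 ^ j * r ≤ dist y x ∧ dist y x < 2 ^ (j + 1) * r := by
  simp [annulus, and_comm]

theorem measurableSet_annulus {X : Type*} [MetricSpace X] [MeasurableSpace X]
    [OpensMeasurableSpace X] (x : X) (r : ℝ) (j : ℕ) : MeasurableSet (annulus x r j) :=
  measurableSet_ball.diff measurableSet_ball

/-- The truncations to the dyadic dilates of a ball differ by the truncation to an annulus. -/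
theorem FunctionSpace.trunc_ball_sub_trunc_ball {𝕜 : Type*} [RCLike 𝕜] {X : Type*} [MetricSpace X]
    [MeasurableSpace X] [OpensMeasurableSpace X] {μ : Measure X} {E : Type*}
    [NormedAddCommGroup E] [NormedSpace 𝕜 E] (F : FunctionSpace 𝕜 μ E) (x : X) {r : ℝ}
    (hr : 0 < r) (n : ℕ) (f : E) :
    F.trunc (Metric.ball x (2 ^ (n + 1) * r)) f - F.trunc (Metric.ball x (2 ^ n * r)) f
      = F.trunc (annulus x r n) f := by
  have hsub : Metric.ball x (2 ^ n * r) ⊆ Metric.ball x (2 ^ (n + 1) * r) :=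
    Metric.ball_subset_ball (by
      gcongr
      · norm_num
      · omega)
  rw [sub_eq_iff_eq_add', ← F.trunc_union measurableSet_ball (measurableSet_annulus _ _ _)
    Set.disjoint_sdiff_right, annulus, Set.union_sdiff_cancel hsub]

theorem BallContinuous.tendstoInMeasure_dyadic {𝕜 : Type*} [RCLike 𝕜] {X : Type*} [MetricSpace X]
    [MeasurableSpace X] {μ : Measure X} {E : Type*} [NormedAddCommGroup E] [NormedSpace 𝕜 E]
    {F : FunctionSpace 𝕜 μ E} {S : E →L[𝕜] E} (hS : BallContinuous F S) (f : E) (x : X) {r : ℝ}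
    (hr : 0 < r) {A : Set X} (hA : A ⊆ Metric.ball x r) :
    TendstoInMeasure (μ.restrict A)
      (fun n : ℕ => (F.toFn (S (F.trunc (Metric.ball x (2 ^ (n + 1) * r)) f)) : X → 𝕜)) atTop
      (F.toFn (S f)) := by
  have h1 : TendstoInMeasure (μ.restrict A)
      (fun (R : ℝ) => (F.toFn (S (F.trunc (Metric.ball x R) f)) : X → 𝕜)) atTop
      (F.toFn (S f)) := fun ε hε =>
    tendsto_of_tendsto_of_tendsto_of_le_of_le tendsto_const_nhds (hS f x r ε hε)
      (fun _ => zero_le) (fun _ => Measure.restrict_mono hA le_rfl _)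
  refine h1.comp (v := atTop) (ns := fun n : ℕ => 2 ^ (n + 1) * r) ?_
  exact ((tendsto_pow_atTop_atTop_of_one_lt one_lt_two).comp
    (tendsto_add_atTop_nat 1)).atTop_mul_const hr

theorem memLp_trunc {𝕜 : Type*} [RCLike 𝕜] {X : Type*} [MeasurableSpace X] {μ : Measure X}
    {E : Type*} [NormedAddCommGroup E] [NormedSpace 𝕜 E] (F : FunctionSpace 𝕜 μ E) {p : ℝ≥0∞}
    {A : Set X} (hA : MeasurableSet A) {f : E}
    (h : eLpNorm (F.toFn f) p (μ.restrict A) ≠ ∞) : MemLp (F.toFn (F.trunc A f)) p μ :=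
  ⟨F.aestronglyMeasurable_toFn _ _, by rw [F.eLpNorm_trunc hA]; exact h.lt_top⟩

section

variable {𝕜 : Type*} [RCLike 𝕜] {X : Type*} [MetricSpace X] [MeasurableSpace X]
  {μ : Measure X} {p q : ℝ≥0∞} {D : ℝ}

theorem avgNorm_ball_eq (hD : IsDoublingWith μ D) (x : X) {r : ℝ} (hr : 0 < r) (S : Set X)
    (h : X → 𝕜) (q : ℝ≥0∞) :
    avgNorm μ q S (Metric.ball x r) h
      = ENNReal.ofReal (μ.real (Metric.ball x r) ^ (-q.toReal⁻¹)) * eLpNorm h q (μ.restrict S) := by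
  have hV := hD.real_pos x hr
  rw [avgNorm, eLpNorm_smul_measure_of_ne_zero (ENNReal.inv_ne_zero.2 (hD.lt_top x r).ne),
    smul_eq_mul, one_div, ENNReal.toReal_inv, ← hD.ofReal_real,
    ← ENNReal.ofReal_inv_of_pos hV, ENNReal.ofReal_rpow_of_pos (by positivity),
    Real.inv_rpow hV.le, Real.rpow_neg hV.le]

/-- Clearing the normalizations in an inequality between averages. The integrability hypothesis
costs nothing, since the right-hand side is infinite without it. -/
theorem eLpNorm_le_of_avgNorm_le (hD : IsDoublingWith μ D) {x y : X} {r s : ℝ} (hr : 0 < r)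
    (hs : 0 < s) {A B : Set X} {g h : X → 𝕜} {K : ℝ} (hK : 0 < K)
    (H : eLpNorm h p (μ.restrict A) ≠ ∞ → avgNorm μ q B (Metric.ball y s) g
      ≤ ENNReal.ofReal K * avgNorm μ p A (Metric.ball x r) h) :
    eLpNorm g q (μ.restrict B) ≤ ENNReal.ofReal (K * (μ.real (Metric.ball y s) ^ q.toReal⁻¹
      * μ.real (Metric.ball x r) ^ (-p.toReal⁻¹))) * eLpNorm h p (μ.restrict A) := by
  have hV := hD.real_pos x hr
  have hW := hD.real_pos y hs
  rcases eq_or_ne (eLpNorm h p (μ.restrict A)) ∞ with htop | htop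
  · rw [htop, ENNReal.mul_top]
    · exact le_top
    · simp only [ne_eq, ENNReal.ofReal_eq_zero, not_le]
      positivity
  have H' := H htop
  rw [avgNorm_ball_eq hD y hs, avgNorm_ball_eq hD x hr] at H'
  have h1 := mul_le_mul_right H' (ENNReal.ofReal (μ.real (Metric.ball y s) ^ q.toReal⁻¹))
  rw [← mul_assoc, ← ENNReal.ofReal_mul (by positivity), ← Real.rpow_add hW, add_neg_cancel,
    Real.rpow_zero, ENNReal.ofReal_one, one_mul] at h1
  refine h1.trans_eq ?_
  rw [← mul_assoc, ← mul_assoc, ← ENNReal.ofReal_mul (by positivity),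
    ← ENNReal.ofReal_mul (by positivity)]
  congr 2
  ring

end

section

variable {𝕜 : Type*} [RCLike 𝕜] {X : Type*} [MetricSpace X] [MeasurableSpace X]
  [OpensMeasurableSpace X]
  {μ : Measure X} {E : Type*} [NormedAddCommGroup E] [NormedSpace 𝕜 E]
  {F : FunctionSpace 𝕜 μ E} {T : ℝ → E →L[𝕜] E} {p q : ℝ≥0∞} {D : ℝ}

/-- The estimate from a ball of radius `2 ^ (-m) r` centered in `B(x, r)` to one of its annuli
inside `B(x, 3r)`, normalized by the mass of `B(x, r)`. -/
theorem eLpNorm_annulus_le (hD : IsDoublingWith μ D) (hp : 1 ≤ p) (hq : 1 ≤ q)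
    {θ₁ θ₂ c C : ℝ} (hθ₁ : 0 < θ₁) (hθ₂ : 0 < θ₂) (hc : 0 < c) (hC : 0 < C)
    (H : ∀ t : ℝ, 0 < t → ∀ (x : X) (r : ℝ), 0 < r → ∀ f : E, MemLp (F.toFn f) p μ →
      ∀ j : ℕ, 2 ≤ j →
        annulusAvg μ q x r j (F.toFn (T t (F.trunc (Metric.ball x r) f)))
            ≤ ENNReal.ofReal (C * (2 ^ ((j : ℝ) * θ₁) * dec (2 ^ j * r / √t) ^ θ₂ *
                Real.exp (-(c * 4 ^ j * r ^ 2 / t)))) * ballAvg μ p x r (F.toFn f))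
    {t : ℝ} (ht : 0 < t) {x y : X} {r ε : ℝ} (hε : 0 < ε) {m : ℕ} (hr' : r = 2 ^ m * ε)
    (hyx : dist y x < 2 ^ m * ε) {j : ℕ} (hj2 : 2 ≤ j) (hjm : j ≤ m) {A : Set X}
    (hA : MeasurableSet A) (hAy : A ⊆ Metric.ball y ε) (f : E) :
    eLpNorm (F.toFn (T t (F.trunc A f))) q (μ.restrict (annulus y ε j))
      ≤ ENNReal.ofReal (C * 2 ^ ((m : ℝ) * θ₁) * (2 ^ m * dec (r / √t)) ^ θ₂
          * Real.exp (-(c * (4 ^ m)⁻¹ * (r / √t) ^ 2))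
          * (D ^ (m + 3) * μ.real (Metric.ball x r) ^ (q.toReal⁻¹ - p.toReal⁻¹)))
        * eLpNorm (F.toFn f) p (μ.restrict A) := by
  have hm0 : (0 : ℝ) < 2 ^ m := by positivity
  have hm1 : (1 : ℝ) ≤ 2 ^ m := one_le_pow₀ (by norm_num)
  have hD1 := hD.one_le
  have hD0 := hD.pos'
  have hr : 0 < r := by rw [hr']; positivity
  have hVy := hD.real_pos y hε
  have hV := hD.real_pos x hr
  set V := μ.real (Metric.ball x r) with hVdef
  have hs : 0 < r / √t := div_pos hr (Real.sqrt_pos.2 ht)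
  have hd : 0 < dec (r / √t) := zero_lt_one.trans_le (one_le_dec hs)
  have hpow : (1 : ℝ) ≤ 2 ^ j := one_le_pow₀ (by norm_num)
  have hpowm : (2 : ℝ) ^ j ≤ 2 ^ m := pow_le_pow_right₀ (by norm_num) hjm
  have hdecj : dec (2 ^ j * ε / √t) ≤ 2 ^ m * dec (r / √t) := by
    have e : 2 ^ j * ε / √t = 2 ^ j / 2 ^ m * (r / √t) := by rw [hr']; field_simp
    rw [e]
    refine (dec_mul_le (by positivity) hs).trans ?_
    gcongr
    refine dec_le_of_le ?_ ?_
    · exact ((div_le_one hm0).2 hpowm).trans hm1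
    · rw [inv_div]; exact div_le_self hm0.le hpow
  have hdj : 0 < dec (2 ^ j * ε / √t) := zero_lt_one.trans_le (one_le_dec (by positivity))
  have hVj := hD.real_pos y (r := 2 ^ (j + 1) * ε) (by positivity)
  have key := eLpNorm_le_of_avgNorm_le (p := p) (q := q) hD (x := y) (y := y) hε
    (s := 2 ^ (j + 1) * ε) (by positivity) (A := A)
    (B := annulus y ε j) (g := F.toFn (T t (F.trunc A f))) (h := F.toFn f)
    (K := C * (2 ^ ((j : ℝ) * θ₁) * dec (2 ^ j * ε / √t) ^ θ₂ *
          Real.exp (-(c * 4 ^ j * ε ^ 2 / t)))) (by positivity) (fun hfin => by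
      have := H t ht y ε hε (F.trunc A f) (memLp_trunc F hA hfin) j hj2
      rw [F.trunc_trunc measurableSet_ball hA, Set.inter_eq_self_of_subset_right hAy] at this
      refine this.trans (mul_le_mul_right (le_of_eq ?_) _)
      rw [ballAvg, avgNorm_ball_eq hD y hε, avgNorm_ball_eq hD y hε,
        F.eLpNorm_restrict_trunc hA measurableSet_ball,
        Set.inter_eq_self_of_subset_right hAy])
  refine key.trans (mul_le_mul_left (ENNReal.ofReal_le_ofReal ?_) _)
  have hq0 : 0 ≤ q.toReal⁻¹ := by positivity
  have hp0 : 0 ≤ p.toReal⁻¹ := by positivity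
  have hmass1 : μ.real (Metric.ball y (2 ^ (j + 1) * ε)) ^ q.toReal⁻¹
      ≤ D ^ 2 * V ^ q.toReal⁻¹ := by
    have h1 : μ.real (Metric.ball y (2 ^ (j + 1) * ε)) ≤ D ^ 2 * V := by
      refine (hD.real_mono (y := x) ?_).trans (hD.real_ball_pow_le x hr 2)
      rw [hr', pow_succ]
      nlinarith
    exact rpow_le_mul_rpow_of_le measureReal_nonneg hV.le (one_le_pow₀ hD1) h1 hq0
      (toReal_inv_le_one hq)
  have hmass2 : μ.real (Metric.ball y ε) ^ (-p.toReal⁻¹)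
      ≤ D ^ (m + 1) * V ^ (-p.toReal⁻¹) := by
    have h1 : V ≤ D ^ (m + 1) * μ.real (Metric.ball y ε) := by
      refine (hD.real_mono (y := y) ?_).trans (hD.real_ball_pow_le y hε (m + 1))
      rw [hr', pow_succ, dist_comm]
      linarith
    have h2 := rpow_le_mul_rpow_of_le hV.le hVy.le (one_le_pow₀ hD1) h1 hp0
      (toReal_inv_le_one hp)
    rw [Real.rpow_neg hVy.le, Real.rpow_neg hV.le, ← div_eq_mul_inv, le_div_iff₀
      (by positivity), inv_mul_le_iff₀ (by positivity)]
    linarith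
  have hexp : Real.exp (-(c * 4 ^ j * ε ^ 2 / t))
      ≤ Real.exp (-(c * (4 ^ m)⁻¹ * (r / √t) ^ 2)) := by
    apply Real.exp_le_exp.2
    have e : c * (4 ^ m)⁻¹ * (r / √t) ^ 2 = c * ε ^ 2 / t := by
      rw [hr', div_pow, Real.sq_sqrt ht.le, mul_pow, ← pow_mul, mul_comm m 2, pow_mul]
      norm_num
      field_simp
    rw [e, neg_le_neg_iff]
    have : (1 : ℝ) ≤ 4 ^ j := one_le_pow₀ (by norm_num)
    gcongr
    nlinarith
  calc _ ≤ C * (2 ^ ((m : ℝ) * θ₁) * (2 ^ m * dec (r / √t)) ^ θ₂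
        * Real.exp (-(c * (4 ^ m)⁻¹ * (r / √t) ^ 2)))
        * ((D ^ 2 * V ^ q.toReal⁻¹) * (D ^ (m + 1) * V ^ (-p.toReal⁻¹))) := by
        gcongr
        norm_num
    _ = _ := by
      rw [sub_eq_add_neg, Real.rpow_add hV]
      ring

/-- Only the first and the third of the off-diagonal estimates on balls enter here: a separated
pair of sets is reduced to a small ball and its annuli by covering the first set with small
balls. -/
theorem OffDiag.loc (hD : IsDoublingWith μ D) (hp : 1 ≤ p) (hq : 1 ≤ q)
    (h : OffDiag F T p q) : Loc F T p q := by
  obtain ⟨θ₁, θ₂, c, C, hθ₁, hθ₂, hc, hC, H⟩ := h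
  have hdec : ∀ {t r : ℝ}, 0 < t → 0 < r → 0 < dec (r / √t) := fun ht hr =>
    zero_lt_one.trans_le (one_le_dec (div_pos hr (Real.sqrt_pos.2 ht)))
  constructor
  · refine ⟨θ₂, C, hθ₂.le, hC, fun t ht x r hr A₁ A₂ hA₁ hA₂ h₁ h₂ _ f => ?_⟩
    have hd := hdec ht hr
    have hV := hD.real_pos x hr
    have key := eLpNorm_le_of_avgNorm_le (p := p) (q := q) hD (x := x) (y := x) hr hr (A := A₁)
      (B := Metric.ball x r) (g := F.toFn (T t (F.trunc A₁ f))) (h := F.toFn f)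
      (K := C * dec (r / √t) ^ θ₂) (by positivity) (fun hfin => by
        have := (H t ht x r hr (F.trunc A₁ f) (memLp_trunc F hA₁ hfin)).1
        rw [F.trunc_trunc measurableSet_ball hA₁, Set.inter_eq_self_of_subset_right h₁] at this
        refine this.trans (mul_le_mul_right (le_of_eq ?_) _)
        rw [ballAvg, avgNorm_ball_eq hD x hr, avgNorm_ball_eq hD x hr,
          F.eLpNorm_restrict_trunc hA₁ measurableSet_ball, Set.inter_eq_self_of_subset_right h₁])
    refine (eLpNorm_mono_measure _ (Measure.restrict_mono h₂ le_rfl)).trans (key.trans_eq ?_)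
    rw [← Real.rpow_add hV, ← sub_eq_add_neg]
    simp
  · intro δ hδ
    obtain ⟨m, hm⟩ := pow_unbounded_of_one_lt (8 / δ) (one_lt_two (α := ℝ))
    have hm0 : (0 : ℝ) < 2 ^ m := by positivity
    have hm1 : (1 : ℝ) ≤ 2 ^ m := one_le_pow₀ (by norm_num)
    have hD1 := hD.one_le
    have hD0 := hD.pos'
    refine ⟨c * (4 ^ m)⁻¹, by positivity, θ₂, D ^ (m + 3) * (m * (C * 2 ^ ((m : ℝ) * θ₁)
      * (2 ^ m) ^ θ₂ * D ^ (m + 3))) + 1, hθ₂.le, by positivity,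
      fun t ht x r hr A₁ A₂ hA₁ hA₂ h₁ h₂ hsep f => ?_⟩
    have hd := hdec ht hr
    have hV := hD.real_pos x hr
    set V := μ.real (Metric.ball x r) with hVdef
    -- the covering balls have radius `ε`, small compared with the separation
    set ε := r / 2 ^ m with hεdef
    have hε : 0 < ε := by positivity
    have hr' : r = 2 ^ m * ε := by rw [hεdef]; field_simp
    have hδε : 8 * ε ≤ δ * r := by
      rw [hr', ← mul_assoc]
      gcongr
      rw [div_lt_iff₀ hδ] at hm
      linarith
    obtain ⟨Y, hYB, hYsep, hYcov⟩ := exists_separated_net (Metric.ball x r) ε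
    have hYdist : ∀ y ∈ Y, dist y x < 2 ^ m * ε := fun y hy => by
      rw [← hr']; exact hYB hy
    have hYfin := hD.finite_of_separated hε x m hYsep hYdist
    obtain ⟨Z, rfl⟩ := hYfin.exists_finset_coe
    have hcard := hD.card_le hε x m Z (fun y hy z hz => hYsep y hy z hz) hYdist
    set K := C * 2 ^ ((m : ℝ) * θ₁) * (2 ^ m * dec (r / √t)) ^ θ₂
      * Real.exp (-(c * (4 ^ m)⁻¹ * (r / √t) ^ 2)) * (D ^ (m + 3) * V ^ (q.toReal⁻¹ - p.toReal⁻¹))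
      with hK
    have hK0 : 0 < K := by positivity
    -- the estimate from a subset of one small ball
    have hpiece : ∀ y ∈ Z, ∀ A, MeasurableSet A → A ⊆ A₁ → A ⊆ Metric.ball y ε →
        eLpNorm (F.toFn (T t (F.trunc A f))) q (μ.restrict A₂)
          ≤ m * ENNReal.ofReal K * eLpNorm (F.toFn f) p (μ.restrict A₁) := by
      intro y hy A hA hAA hAy
      rcases A.eq_empty_or_nonempty with rfl | ⟨a, ha⟩
      · rw [F.trunc_empty, map_zero, map_zero, eLpNorm_congr_ae
          (ae_restrict_of_ae (AEEqFun.coeFn_zero (μ := μ) (β := 𝕜)))]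
        simp
      have hyx := hYdist y hy
      have hcov : A₂ ⊆ ⋃ j ∈ Finset.Icc 2 m, annulus y ε j := by
        intro b hb
        have h1 := hsep a (hAA ha) b hb
        have h2 : dist a y < ε := hAy ha
        have h3 : dist b x < 2 ^ m * ε := by rw [← hr']; exact h₂ hb
        have h4 : 4 * ε ≤ dist b y := by
          have := dist_triangle a y b
          rw [dist_comm y b] at this
          linarith
        have h5 : dist b y < 2 ^ (m + 1) * ε := by
          have := dist_triangle_right b y x
          rw [pow_succ]
          linarith
        obtain ⟨j, hj1, hj2⟩ := exists_nat_pow_near (x := dist b y / ε) (y := 2)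
          (by rw [le_div_iff₀ hε]; linarith) one_lt_two
        rw [le_div_iff₀ hε] at hj1
        rw [div_lt_iff₀ hε] at hj2
        have hj2' : 2 ≤ j := by
          by_contra hlt
          have : (2 : ℝ) ^ (j + 1) ≤ 2 ^ 2 := pow_le_pow_right₀ (by norm_num) (by omega)
          nlinarith
        have hjm : j ≤ m := by
          by_contra hlt
          have : (2 : ℝ) ^ (m + 1) ≤ 2 ^ j := pow_le_pow_right₀ (by norm_num) (by omega)
          nlinarith
        exact Set.mem_biUnion (Finset.mem_coe.2 (Finset.mem_Icc.2 ⟨hj2', hjm⟩))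
          (mem_annulus.2 ⟨hj1, hj2⟩)
      have hj : ∀ j ∈ Finset.Icc 2 m, eLpNorm (F.toFn (T t (F.trunc A f))) q
          (μ.restrict (annulus y ε j))
            ≤ ENNReal.ofReal K * eLpNorm (F.toFn f) p (μ.restrict A₁) := by
        intro j hj
        obtain ⟨hj2, hjm⟩ := Finset.mem_Icc.1 hj
        refine (eLpNorm_annulus_le hD hp hq hθ₁ hθ₂ hc hC
          (fun t ht x r hr f hf j hj => ((H t ht x r hr f hf).2 j hj).2) ht hε hr' hyx hj2 hjm hA
          hAy f).trans ?_
        gcongr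
      refine (eLpNorm_restrict_le_card_mul (F.aestronglyMeasurable_toFn _ _) _
        (measurableSet_annulus y ε) hq hj hcov).trans ?_
      rw [mul_assoc]
      gcongr
      rw [Nat.card_Icc]
      omega
    have hall : ∀ W ⊆ Z, ∀ A, MeasurableSet A → A ⊆ A₁ → A ⊆ ⋃ y ∈ W, Metric.ball y ε →
        eLpNorm (F.toFn (T t (F.trunc A f))) q (μ.restrict A₂)
          ≤ W.card * (m * ENNReal.ofReal K * eLpNorm (F.toFn f) p (μ.restrict A₁)) := by
      intro W
      induction W using Finset.cons_induction with
      | empty =>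
        intro _ A _ _ hA
        have : A = ∅ := by simpa using hA
        subst this
        rw [F.trunc_empty, map_zero, map_zero, eLpNorm_congr_ae
          (ae_restrict_of_ae (AEEqFun.coeFn_zero (μ := μ) (β := 𝕜)))]
        simp
      | cons y W hy ih =>
        intro hW A hA hAA hAW
        have e : F.trunc A f
            = F.trunc (A ∩ Metric.ball y ε) f + F.trunc (A \ Metric.ball y ε) f := by
          rw [← F.trunc_union (hA.inter measurableSet_ball) (hA.diff measurableSet_ball)
            Set.disjoint_sdiff_inter.symm, Set.inter_union_sdiff]
        rw [e, map_add, Finset.card_cons, Nat.cast_add, Nat.cast_one, add_mul, one_mul]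
        refine (F.eLpNorm_toFn_add_le _ _ hq _).trans ((add_comm _ _).trans_le ?_)
        refine add_le_add (ih (fun z hz => hW (by simp [hz])) _ (hA.diff measurableSet_ball)
          (Set.sdiff_subset.trans hAA) ?_) (hpiece y (hW (by simp)) _ (hA.inter measurableSet_ball)
          (Set.inter_subset_left.trans hAA) Set.inter_subset_right)
        rintro z ⟨hzA, hz⟩
        have := hAW hzA
        simp only [Finset.mem_cons, Set.mem_iUnion, exists_prop] at this ⊢
        obtain ⟨w, rfl | hw, hzw⟩ := this
        · exact absurd hzw hz
        · exact ⟨w, hw, hzw⟩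
    refine (hall Z (Finset.Subset.refl _) A₁ hA₁ le_rfl ?_).trans ?_
    · intro a ha
      by_cases haZ : a ∈ Z
      · exact Set.mem_biUnion haZ (Metric.mem_ball_self hε)
      · obtain ⟨y, hy, hay⟩ := hYcov a (h₁ ha) haZ
        exact Set.mem_biUnion hy hay
    · rw [← mul_assoc, ← mul_assoc]
      gcongr
      rw [← ENNReal.ofReal_natCast, ← ENNReal.ofReal_natCast,
        ← ENNReal.ofReal_mul (Nat.cast_nonneg _),
        ← ENNReal.ofReal_mul (mul_nonneg (Nat.cast_nonneg _) (Nat.cast_nonneg _))]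
      apply ENNReal.ofReal_le_ofReal
      calc (Z.card : ℝ) * m * K ≤ D ^ (m + 3) * m * K := by gcongr
        _ = D ^ (m + 3) * (m * (C * 2 ^ ((m : ℝ) * θ₁) * (2 ^ m) ^ θ₂ * D ^ (m + 3)))
            * dec (r / √t) ^ θ₂ * Real.exp (-(c * (4 ^ m)⁻¹ * (r / √t) ^ 2))
              * V ^ (q.toReal⁻¹ - p.toReal⁻¹) := by
            rw [hK, Real.mul_rpow hm0.le hd.le]
            ring
        _ ≤ _ := by
            gcongr
            linarith

/-- The polynomial factor `2^{j θ₁}` absorbs the ratio of the masses of the ball and its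
dilates. -/
theorem Loc.offDiag (hD : IsDoublingWith μ D) (hq : 1 ≤ q) (h : Loc F T p q) :
    OffDiag F T p q := by
  obtain ⟨⟨N₀, C₀, hN₀, hC₀, H₀⟩, hsep⟩ := h
  obtain ⟨c, hc, N₁, C₁, hN₁, hC₁, H₁⟩ := hsep (1 / 4) (by norm_num)
  obtain ⟨n, hn⟩ := pow_unbounded_of_one_lt D (one_lt_two (α := ℝ))
  have hD0 := hD.pos'
  have hC0' : C₀ ≤ C₀ + C₁ * 2 ^ N₁ * 2 ^ n := by
    have : 0 < C₁ * 2 ^ N₁ * 2 ^ n := by positivity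
    linarith
  refine ⟨n + 1, N₀ + N₁ + 1, c, C₀ + C₁ * 2 ^ N₁ * 2 ^ n, by positivity, by positivity, hc,
    by positivity, fun t ht x r hr f _ => ?_⟩
  have hs : 0 < r / √t := div_pos hr (Real.sqrt_pos.2 ht)
  have hV := hD.real_pos x hr
  have hVp : ∀ e : ℝ, 0 < μ.real (Metric.ball x r) ^ e := fun e => by positivity
  constructor
  · have hd := one_le_dec hs
    rw [ballAvg, ballAvg, avgNorm_ball_eq hD x hr, avgNorm_ball_eq hD x hr]
    refine (mul_le_mul_right (H₀ t ht x r hr _ _ measurableSet_ball measurableSet_ball le_rfl le_rfl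
      (fun a _ b _ => by simp) f) _).trans ?_
    rw [← mul_assoc, ← mul_assoc, ← ENNReal.ofReal_mul (by positivity),
      ← ENNReal.ofReal_mul (by positivity)]
    gcongr ENNReal.ofReal ?_ * _
    rw [sub_eq_add_neg, Real.rpow_add hV, Real.rpow_neg hV.le q.toReal⁻¹]
    have e : (μ.real (Metric.ball x r) ^ q.toReal⁻¹)⁻¹ * (C₀ * dec (r / √t) ^ N₀
        * Real.exp (-(0 * (r / √t) ^ 2)) * (μ.real (Metric.ball x r) ^ q.toReal⁻¹
          * μ.real (Metric.ball x r) ^ (-p.toReal⁻¹)))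
        = C₀ * dec (r / √t) ^ N₀ * μ.real (Metric.ball x r) ^ (-p.toReal⁻¹) := by
      have := (hVp q.toReal⁻¹).ne'
      rw [zero_mul, neg_zero, Real.exp_zero]
      field_simp
    rw [e]
    gcongr
    linarith
  · intro j hj
    have hR : 0 < 2 ^ (j + 1) * r := by positivity
    have hW := hD.real_pos x hR
    set V := μ.real (Metric.ball x r) with hVdef
    set W := μ.real (Metric.ball x (2 ^ (j + 1) * r)) with hWdef
    have hpow : (1 : ℝ) ≤ 2 ^ j := one_le_pow₀ (by norm_num)
    have hpow4 : (4 : ℝ) ≤ 2 ^ j := by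
      calc (4 : ℝ) = 2 ^ 2 := by norm_num
        _ ≤ 2 ^ j := pow_le_pow_right₀ (by norm_num) hj
    have hBj : Metric.ball x r ⊆ Metric.ball x (2 ^ (j + 1) * r) :=
      Metric.ball_subset_ball (by rw [pow_succ]; nlinarith)
    have hAj : annulus x r j ⊆ Metric.ball x (2 ^ (j + 1) * r) := Set.sdiff_subset
    have hdist : ∀ a ∈ Metric.ball x r, ∀ b ∈ annulus x r j,
        1 / 4 * (2 ^ (j + 1) * r) ≤ dist a b := by
      intro a ha b hb
      have h1 := (mem_annulus.1 hb).1
      have h2 : dist a x < r := ha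
      have h3 := dist_triangle_left b x a
      rw [pow_succ]
      nlinarith
    set s := 2 ^ j * r / √t with hsdef
    have hs0 : 0 < s := by positivity
    have hd := one_le_dec hs0
    have es : 2 ^ (j + 1) * r / √t = 2 ^ 1 * s := by rw [hsdef]; ring
    have hdec1 : dec (2 ^ (j + 1) * r / √t) ≤ 2 * dec s := by
      rw [es]
      simpa using dec_two_pow_mul_le 1 hs0
    have hdec0 : 0 < dec (2 ^ (j + 1) * r / √t) :=
      zero_lt_one.trans_le (one_le_dec (by positivity))
    have hexp : Real.exp (-(c * (2 ^ (j + 1) * r / √t) ^ 2))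
        ≤ Real.exp (-(c * 4 ^ j * r ^ 2 / t)) := by
      apply Real.exp_le_exp.2
      have e : c * 4 ^ j * r ^ 2 / t = c * s ^ 2 := by
        rw [hsdef, div_pow, Real.sq_sqrt ht.le, mul_pow, ← pow_mul, mul_comm j 2, pow_mul]
        norm_num
        ring
      rw [e, neg_le_neg_iff, es]
      gcongr
      linarith
    have hkernel : C₁ * dec (2 ^ (j + 1) * r / √t) ^ N₁
        * Real.exp (-(c * (2 ^ (j + 1) * r / √t) ^ 2)) * (2 ^ n * 2 ^ ((j : ℝ) * n))
        ≤ (C₀ + C₁ * 2 ^ N₁ * 2 ^ n) * (2 ^ ((j : ℝ) * (n + 1)) * dec s ^ (N₀ + N₁ + 1) *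
                Real.exp (-(c * 4 ^ j * r ^ 2 / t))) := by
      calc _ ≤ C₁ * (2 * dec s) ^ N₁ * Real.exp (-(c * 4 ^ j * r ^ 2 / t))
              * (2 ^ n * 2 ^ ((j : ℝ) * n)) := by gcongr
        _ = (C₁ * 2 ^ N₁ * 2 ^ n) * (2 ^ ((j : ℝ) * n) * dec s ^ N₁ *
                Real.exp (-(c * 4 ^ j * r ^ 2 / t))) := by
            rw [Real.mul_rpow (by norm_num) (by linarith)]
            ring
        _ ≤ _ := by
            gcongr
            · linarith
            · norm_num
            · linarith
            · linarith
    have hone : (1 : ℝ) ≤ 2 ^ n * 2 ^ ((j : ℝ) * n) :=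
      one_le_mul_of_one_le_of_one_le (one_le_pow₀ (by norm_num))
        (Real.one_le_rpow (by norm_num) (by positivity))
    have hVW : V ≤ W := hD.real_mono (by
      rw [dist_self, pow_succ]
      nlinarith)
    have hWV : W ≤ 2 ^ n * 2 ^ ((j : ℝ) * n) * V := by
      refine (hD.real_ball_pow_le x hr (j + 1)).trans ?_
      have e : (2 : ℝ) ^ n * 2 ^ ((j : ℝ) * n) = (2 ^ n) ^ (j + 1) := by
        rw [← Nat.cast_mul, Real.rpow_natCast]
        ring
      rw [e]
      gcongr
    rw [annulusAvg, ballAvg, annulusAvg, ballAvg, avgNorm_ball_eq hD x hr,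
      avgNorm_ball_eq hD x hr, avgNorm_ball_eq hD x hR, avgNorm_ball_eq hD x hR]
    constructor
    · refine (mul_le_mul_right (H₁ t ht x _ hR _ _ (measurableSet_annulus x r j) measurableSet_ball
        hAj hBj (fun a ha b hb => by rw [dist_comm]; exact hdist b hb a ha) f) _).trans ?_
      rw [← mul_assoc, ← mul_assoc, ← ENNReal.ofReal_mul (by positivity),
        ← ENNReal.ofReal_mul (by positivity)]
      gcongr ENNReal.ofReal ?_ * _
      have hratio : V ^ (-q.toReal⁻¹) * W ^ q.toReal⁻¹ ≤ 2 ^ n * 2 ^ ((j : ℝ) * n) := by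
        rw [Real.rpow_neg hV.le, inv_mul_le_iff₀ (by positivity)]
        have := rpow_le_mul_rpow_of_le hW.le hV.le hone hWV (by positivity)
          (toReal_inv_le_one hq)
        linarith
      rw [← hWdef, sub_eq_add_neg, Real.rpow_add hW]
      calc _ = C₁ * dec (2 ^ (j + 1) * r / √t) ^ N₁
            * Real.exp (-(c * (2 ^ (j + 1) * r / √t) ^ 2)) * (V ^ (-q.toReal⁻¹) * W ^ q.toReal⁻¹)
              * W ^ (-p.toReal⁻¹) := by ring
        _ ≤ C₁ * dec (2 ^ (j + 1) * r / √t) ^ N₁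
            * Real.exp (-(c * (2 ^ (j + 1) * r / √t) ^ 2)) * (2 ^ n * 2 ^ ((j : ℝ) * n))
              * W ^ (-p.toReal⁻¹) := by gcongr
        _ ≤ _ := by gcongr
    · refine (mul_le_mul_right (H₁ t ht x _ hR _ _ measurableSet_ball (measurableSet_annulus x r j)
        hBj hAj hdist f) _).trans ?_
      rw [← mul_assoc, ← mul_assoc, ← ENNReal.ofReal_mul (by positivity),
        ← ENNReal.ofReal_mul (by positivity)]
      gcongr ENNReal.ofReal ?_ * _
      have hWp : W ^ (-p.toReal⁻¹) ≤ V ^ (-p.toReal⁻¹) :=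
        Real.rpow_le_rpow_of_nonpos hV hVW (by
          have : 0 ≤ p.toReal⁻¹ := by positivity
          linarith)
      have hWq : W ^ (-q.toReal⁻¹) * W ^ q.toReal⁻¹ = 1 := by
        rw [← Real.rpow_add hW]; simp
      rw [← hWdef, sub_eq_add_neg, Real.rpow_add hW]
      calc _ = C₁ * dec (2 ^ (j + 1) * r / √t) ^ N₁
            * Real.exp (-(c * (2 ^ (j + 1) * r / √t) ^ 2)) * (W ^ (-q.toReal⁻¹) * W ^ q.toReal⁻¹)
              * W ^ (-p.toReal⁻¹) := by ring
        _ ≤ C₁ * dec (2 ^ (j + 1) * r / √t) ^ N₁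
            * Real.exp (-(c * (2 ^ (j + 1) * r / √t) ^ 2)) * (2 ^ n * 2 ^ ((j : ℝ) * n))
              * V ^ (-p.toReal⁻¹) := by rw [hWq]; gcongr
        _ ≤ _ := by gcongr

end

/-! ### Interpolation of local estimates -/

section

variable {𝕜 : Type*} [RCLike 𝕜] {X : Type*} [MetricSpace X] [MeasurableSpace X]
  {μ : Measure X} {E : Type*} [NormedAddCommGroup E] [NormedSpace 𝕜 E]
  {F : FunctionSpace 𝕜 μ E} {T : ℝ → E →L[𝕜] E} {p q : ℝ≥0∞} {D : ℝ}

/-- Interpolation of a local estimate with decay and a local estimate without decay. A fraction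
of the decay survives. -/
theorem LocEst.interpolation (hD : IsDoublingWith μ D) {p₀ q₀ p₁ q₁ r s : ℝ≥0∞} {δ c : ℝ}
    (h₀ : LocEst F T p₀ q₀ δ c) (h₁ : LocEst F T p₁ q₁ 0 0)
    (hp₀ : 1 ≤ p₀) (hp₁ : 1 ≤ p₁) (hq₀ : 1 ≤ q₀) (hq₁ : 1 ≤ q₁) (hs : 1 ≤ s) (hr : 1 ≤ r)
    (hr' : r ≠ ∞) {τ : ℝ} (hτ0 : 0 < τ) (hτ1 : τ < 1)
    (hτ : s.toReal⁻¹ = (1 - τ) * q₀.toReal⁻¹ + τ * q₁.toReal⁻¹)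
    (hloss : 1 < r.toReal * ((1 - τ) * p₀.toReal⁻¹ + τ * p₁.toReal⁻¹)) :
    LocEst F T r s δ ((1 - τ) * c) := by
  obtain ⟨N₀, C₀, hN₀, hC₀, H₀⟩ := h₀
  obtain ⟨N₁, C₁, hN₁, hC₁, H₁⟩ := h₁
  have hτ' : 0 < 1 - τ := by linarith
  set α := (1 - τ) * p₀.toReal⁻¹ + τ * p₁.toReal⁻¹ with hα
  have hρ : (0 : ℝ) < (1 - 2 ^ (1 - r.toReal * α))⁻¹ := inv_pos.2 (sub_pos.2
    (Real.rpow_lt_one_of_one_lt_of_neg (by norm_num) (by linarith)))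
  refine ⟨(1 - τ) * N₀ + τ * N₁,
    (1 + 2 * (1 - 2 ^ (1 - r.toReal * α))⁻¹) * (C₀ ^ (1 - τ) * C₁ ^ τ),
    by positivity, by positivity, fun t ht x R hR A₁ A₂ hA₁ hA₂ hB₁ hB₂ hsep f => ?_⟩
  have hV := hD.real_pos x hR
  have hd : 0 < dec (R / √t) := zero_lt_one.trans_le (one_le_dec (div_pos hR (Real.sqrt_pos.2 ht)))
  have hAV : μ A₁ ≤ ENNReal.ofReal (μ.real (Metric.ball x R)) := by
    rw [hD.ofReal_real]
    exact measure_mono hB₁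
  have key := F.interpolation (T t) hA₁ (A₂ := A₂) hp₀ hp₁ hq₀ hq₁ hs hr hr' hτ0 hτ1 hτ hloss hV hAV
    (by positivity) (by positivity)
    (fun f => H₀ t ht x R hR A₁ A₂ hA₁ hA₂ hB₁ hB₂ hsep f)
    (fun f => H₁ t ht x R hR A₁ A₂ hA₁ hA₂ hB₁ hB₂ (fun a _ b _ => by simp) f) f
  refine key.trans_eq ?_
  congr 2
  rw [← hα]
  have hκ : 0 < 1 + 2 * (1 - (2 : ℝ) ^ (1 - r.toReal * α))⁻¹ := by positivity
  generalize 1 + 2 * (1 - (2 : ℝ) ^ (1 - r.toReal * α))⁻¹ = κ at hκ ⊢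
  set V := μ.real (Metric.ball x R)
  set d := dec (R / √t)
  apply Real.log_injOn_pos (Set.mem_Ioi.2 (by positivity)) (Set.mem_Ioi.2 (by positivity))
  have hlog : ∀ C N a e : ℝ, 0 < C → Real.log (C * d ^ N * Real.exp a * V ^ e)
      = Real.log C + N * Real.log d + a + e * Real.log V := by
    intro C N a e hC
    rw [Real.log_mul (by positivity) (by positivity), Real.log_mul (by positivity) (by positivity),
      Real.log_mul (by positivity) (by positivity), Real.log_rpow hd, Real.log_exp,
      Real.log_rpow hV]
  have hlog2 : ∀ a b : ℝ, 0 < a → 0 < b → Real.log (κ * (a ^ (1 - τ) * b ^ τ))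
      = Real.log κ + ((1 - τ) * Real.log a + τ * Real.log b) := by
    intro a b ha hb
    rw [Real.log_mul (by positivity) (by positivity), Real.log_mul (by positivity) (by positivity),
      Real.log_rpow ha, Real.log_rpow hb]
  rw [Real.log_mul (by positivity) (by positivity), hlog2 _ _ (by positivity) (by positivity),
    Real.log_rpow hV, hlog _ _ _ _ hC₀, hlog _ _ _ _ hC₁, hlog _ _ _ _ (by positivity),
    hlog2 _ _ hC₀ hC₁, hτ, hα]
  ring

theorem Loc.interpolation (hD : IsDoublingWith μ D) {p₀ q₀ p₁ q₁ r s : ℝ≥0∞}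
    (h₀ : Loc F T p₀ q₀) (h₁ : LocEst F T p₁ q₁ 0 0)
    (hp₀ : 1 ≤ p₀) (hp₁ : 1 ≤ p₁) (hq₀ : 1 ≤ q₀) (hq₁ : 1 ≤ q₁) (hs : 1 ≤ s) (hr : 1 ≤ r)
    (hr' : r ≠ ∞) {τ : ℝ} (hτ0 : 0 < τ) (hτ1 : τ < 1)
    (hτ : s.toReal⁻¹ = (1 - τ) * q₀.toReal⁻¹ + τ * q₁.toReal⁻¹)
    (hloss : 1 < r.toReal * ((1 - τ) * p₀.toReal⁻¹ + τ * p₁.toReal⁻¹)) :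
    Loc F T r s := by
  constructor
  · simpa using h₀.1.interpolation hD h₁ hp₀ hp₁ hq₀ hq₁ hs hr hr' hτ0 hτ1 hτ hloss
  · intro δ hδ
    obtain ⟨c, hc, h⟩ := h₀.2 δ hδ
    exact ⟨(1 - τ) * c, mul_pos (by linarith) hc,
      h.interpolation hD h₁ hp₀ hp₁ hq₀ hq₁ hs hr hr' hτ0 hτ1 hτ hloss⟩

/-- Uniform boundedness on `L^p` is a local estimate without decay. -/
theorem locEst_of_mem_boundedExponents (hp : p ∈ boundedExponents F T) : LocEst F T p p 0 0 := by
  obtain ⟨hp1, C, hC⟩ := hp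
  refine ⟨0, C + 1, le_rfl, by positivity, fun t ht x r hr A₁ A₂ hA₁ hA₂ h₁ h₂ _ f => ?_⟩
  simp only [Real.rpow_zero, zero_mul, neg_zero, Real.exp_zero, mul_one, sub_self]
  rcases eq_or_ne (eLpNorm (F.toFn f) p (μ.restrict A₁)) ∞ with htop | htop
  · rw [htop, ENNReal.mul_top]
    · exact le_top
    · simp only [ne_eq, ENNReal.ofReal_eq_zero, not_le]
      positivity
  refine (eLpNorm_mono_measure _ Measure.restrict_le_self).trans ?_
  refine (hC t ht _ (memLp_trunc F hA₁ htop)).trans ?_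
  rw [F.eLpNorm_trunc hA₁]
  gcongr
  rw [← ENNReal.ofReal_coe_nnreal]
  exact ENNReal.ofReal_le_ofReal (by linarith)

end

/-! ### Composition of local estimates -/

theorem exists_rpow_mul_exp_le (M : ℝ) {b : ℝ} (hb : 0 < b) :
    ∃ K : ℝ, 0 < K ∧ ∀ y : ℝ, 0 < y → 0 ≤ M → y ^ M * Real.exp (-(b * y ^ 2)) ≤ K := by
  obtain ⟨k, hk⟩ := exists_nat_ge M
  refine ⟨1 + k.factorial / b ^ k, by positivity, fun y hy hM => ?_⟩
  rcases le_total y 1 with h | h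
  · have h1 : y ^ M ≤ 1 := Real.rpow_le_one hy.le h hM
    have h2 : Real.exp (-(b * y ^ 2)) ≤ 1 := Real.exp_le_one_iff.2 (by
      have : 0 < b * y ^ 2 := by positivity
      linarith)
    have h3 : 0 ≤ (k.factorial : ℝ) / b ^ k := by positivity
    calc y ^ M * Real.exp (-(b * y ^ 2)) ≤ 1 * 1 := by gcongr
      _ ≤ _ := by linarith
  · have h1 : y ^ M ≤ (y ^ 2) ^ k := by
      rw [← pow_mul, ← Real.rpow_natCast]
      apply Real.rpow_le_rpow_of_exponent_le h
      push_cast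
      linarith
    have h2 := Real.pow_div_factorial_le_exp (b * y ^ 2) (by positivity) k
    rw [Real.exp_neg, ← div_eq_mul_inv, div_le_iff₀ (Real.exp_pos _)]
    have h3 : (y ^ 2) ^ k ≤ k.factorial / b ^ k * Real.exp (b * y ^ 2) := by
      rw [mul_pow, div_le_iff₀ (by positivity)] at h2
      rw [div_mul_eq_mul_div, le_div_iff₀ (by positivity)]
      linarith
    have := Real.exp_pos (b * y ^ 2)
    nlinarith

/-- Gaussian factors at the dyadic dilates of `s` sum up to a Gaussian factor at `s`. -/
theorem exists_dec_mul_exp_le {N a : ℝ} (hN : 0 ≤ N) (ha : 0 < a) :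
    ∃ K : ℝ, 0 < K ∧ ∀ s : ℝ, 0 < s → ∀ n : ℕ,
      dec (2 ^ (n + 2) * s) ^ N * Real.exp (-(a * (2 ^ (n + 2) * s) ^ 2))
        ≤ K * (1 / 2) ^ n * dec s ^ (2 * N + 1) * Real.exp (-(a / 2 * s ^ 2)) := by
  obtain ⟨K, hK, h⟩ := exists_rpow_mul_exp_le (N + 1) (half_pos ha)
  refine ⟨K, hK, fun s hs n => ?_⟩
  set P : ℝ := 2 ^ (n + 2) with hP
  have hP1 : 1 ≤ P := one_le_pow₀ (by norm_num)
  have hP0 : 0 < P := by positivity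
  have hd := one_le_dec hs
  have hd0 : 0 < dec s := by linarith
  have hdP : 0 ≤ dec (P * s) := zero_le_one.trans (one_le_dec (by positivity))
  have h1 := h (P * s) (by positivity) (by linarith)
  have h2 : dec (P * s) ^ N ≤ P ^ N * dec s ^ N := by
    rw [← Real.mul_rpow hP0.le hd0.le]
    exact Real.rpow_le_rpow hdP (dec_two_pow_mul_le _ hs) hN
  have h3 : Real.exp (-(a * (P * s) ^ 2))
      ≤ Real.exp (-(a / 2 * s ^ 2)) * Real.exp (-(a / 2 * (P * s) ^ 2)) := by
    rw [← Real.exp_add]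
    apply Real.exp_le_exp.2
    have : s ^ 2 ≤ (P * s) ^ 2 := by
      gcongr
      nlinarith
    nlinarith
  have h4 : Real.exp (-(a / 2 * (P * s) ^ 2)) ≤ K * (P⁻¹ ^ (N + 1) * dec s ^ (N + 1)) := by
    have h5 : 0 < (P * s) ^ (N + 1) := by positivity
    have h6 : Real.exp (-(a / 2 * (P * s) ^ 2)) ≤ K * ((P * s) ^ (N + 1))⁻¹ := by
      rw [← div_eq_mul_inv, le_div_iff₀ h5, mul_comm]
      exact h1
    refine h6.trans ?_
    rw [← Real.inv_rpow (by positivity), mul_inv, Real.mul_rpow (by positivity) (by positivity)]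
    gcongr
    exact le_max_right _ _
  have h7 : P ^ N * P⁻¹ ^ (N + 1) ≤ (1 / 2) ^ n := by
    rw [Real.inv_rpow hP0.le, Real.rpow_add hP0, Real.rpow_one, mul_inv, ← mul_assoc,
      mul_inv_cancel₀ (by positivity), one_mul, one_div, inv_pow, hP]
    gcongr
    · norm_num
    · omega
  calc _ ≤ (P ^ N * dec s ^ N) * (Real.exp (-(a / 2 * s ^ 2))
        * (K * (P⁻¹ ^ (N + 1) * dec s ^ (N + 1)))) :=
        mul_le_mul h2 (h3.trans (mul_le_mul_of_nonneg_left h4 (Real.exp_nonneg _)))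
          (Real.exp_nonneg _) (by positivity)
    _ = K * (P ^ N * P⁻¹ ^ (N + 1)) * (dec s ^ N * dec s ^ (N + 1))
        * Real.exp (-(a / 2 * s ^ 2)) := by ring
    _ = K * (P ^ N * P⁻¹ ^ (N + 1)) * dec s ^ (2 * N + 1) * Real.exp (-(a / 2 * s ^ 2)) := by
        rw [← Real.rpow_add hd0]
        ring_nf
    _ ≤ _ := by gcongr

section

variable {𝕜 : Type*} [RCLike 𝕜] {X : Type*} [MetricSpace X] [MeasurableSpace X]
  {μ : Measure X} {E : Type*} [NormedAddCommGroup E] [NormedSpace 𝕜 E]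
  {F : FunctionSpace 𝕜 μ E} {T : ℝ → E →L[𝕜] E} {p q r : ℝ≥0∞} {D : ℝ}

/-- Two local estimates in a row, with a truncation to a subset `A` of the ball in between. -/
theorem LocEst.two_step (hD : IsDoublingWith μ D) {δ₁ c₁ δ₂ c₂ : ℝ} (h₁ : LocEst F T p q δ₁ c₁)
    (h₂ : LocEst F T q r δ₂ c₂) :
    ∃ N C : ℝ, 0 ≤ N ∧ 0 < C ∧ ∀ t : ℝ, 0 < t → ∀ (x : X) (R : ℝ), 0 < R →
      ∀ A₁ A A₂ : Set X, MeasurableSet A₁ → MeasurableSet A → MeasurableSet A₂ →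
        A₁ ⊆ Metric.ball x R → A ⊆ Metric.ball x R → A₂ ⊆ Metric.ball x R →
        (∀ a ∈ A₁, ∀ b ∈ A, δ₁ * R ≤ dist a b) → (∀ a ∈ A, ∀ b ∈ A₂, δ₂ * R ≤ dist a b) → ∀ f : E,
        eLpNorm (F.toFn (T t (F.trunc A (T t (F.trunc A₁ f))))) r (μ.restrict A₂)
          ≤ ENNReal.ofReal (C * (dec (R / √t) ^ N * Real.exp (-((c₁ + c₂) * (R / √t) ^ 2)))
              * μ.real (Metric.ball x R) ^ (r.toReal⁻¹ - p.toReal⁻¹))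
            * eLpNorm (F.toFn f) p (μ.restrict A₁) := by
  obtain ⟨N₁, C₁, hN₁, hC₁, H₁⟩ := h₁
  obtain ⟨N₂, C₂, hN₂, hC₂, H₂⟩ := h₂
  refine ⟨N₂ + N₁, C₂ * C₁, by positivity, by positivity, fun t ht x R hR A₁ A A₂ hA₁ hA hA₂
    hB₁ hB hB₂ hs₁ hs₂ f => ?_⟩
  have hV := hD.real_pos x hR
  have hd : 0 < dec (R / √t) := zero_lt_one.trans_le (one_le_dec (div_pos hR (Real.sqrt_pos.2 ht)))
  refine (H₂ t ht x R hR A A₂ hA hA₂ hB hB₂ hs₂ _).trans ?_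
  refine (mul_le_mul_right (H₁ t ht x R hR A₁ A hA₁ hA hB₁ hB hs₁ f) _).trans_eq ?_
  rw [← mul_assoc, ← ENNReal.ofReal_mul (by positivity)]
  congr 2
  have e : r.toReal⁻¹ - p.toReal⁻¹
      = (r.toReal⁻¹ - q.toReal⁻¹) + (q.toReal⁻¹ - p.toReal⁻¹) := by ring
  have e2 : -((c₁ + c₂) * (R / √t) ^ 2) = -(c₂ * (R / √t) ^ 2) + -(c₁ * (R / √t) ^ 2) := by ring
  rw [e, e2, Real.rpow_add hV, Real.rpow_add hd, Real.exp_add]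
  ring

/-- Estimates for the family `T t ∘ T t` are estimates for `T`, since `T t = T (t/2) ∘ T (t/2)`. -/
theorem LocEst.of_sq {δ c : ℝ} (hc : 0 ≤ c) (h : LocEst F (fun t => (T t).comp (T t)) p q δ c)
    (hT : ∀ s t : ℝ, 0 < s → 0 < t → (T s).comp (T t) = T (s + t)) : LocEst F T p q δ c := by
  obtain ⟨N, C, hN, hC, H⟩ := h
  refine ⟨N, C * 2 ^ N, hN, by positivity, fun t ht x R hR A₁ A₂ hA₁ hA₂ hB₁ hB₂ hsep f => ?_⟩
  have h1 := H (t / 2) (half_pos ht) x R hR A₁ A₂ hA₁ hA₂ hB₁ hB₂ hsep f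
  simp only [hT _ _ (half_pos ht) (half_pos ht), add_halves] at h1
  refine h1.trans ?_
  gcongr ENNReal.ofReal ?_ * _
  have hs : 0 < R / √t := div_pos hR (Real.sqrt_pos.2 ht)
  have hs' : 0 < R / √(t / 2) := div_pos hR (Real.sqrt_pos.2 (half_pos ht))
  have hd := one_le_dec hs
  have e : R / √(t / 2) = √2 * (R / √t) := by
    rw [Real.sqrt_div ht.le]
    field_simp
  have h2 : dec (R / √(t / 2)) ≤ 2 * dec (R / √t) := by
    rw [e]
    refine (dec_mul_le (by positivity) hs).trans ?_
    gcongr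
    have h3 : √2 ≤ 2 := Real.sqrt_le_iff.2 (by norm_num)
    have h4 : 1 ≤ √2 := Real.one_le_sqrt.2 (by norm_num)
    exact dec_le_of_le h3 ((inv_le_one_of_one_le₀ h4).trans (by norm_num))
  have h3 : Real.exp (-(c * (R / √(t / 2)) ^ 2)) ≤ Real.exp (-(c * (R / √t) ^ 2)) := by
    apply Real.exp_le_exp.2
    rw [e, mul_pow, Real.sq_sqrt (by norm_num), neg_le_neg_iff]
    gcongr
    nlinarith [sq_nonneg (R / √t)]
  have hd' : 0 ≤ dec (R / √(t / 2)) := zero_le_one.trans (one_le_dec hs')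
  calc _ ≤ C * (2 * dec (R / √t)) ^ N * Real.exp (-(c * (R / √t) ^ 2))
        * μ.real (Metric.ball x R) ^ (q.toReal⁻¹ - p.toReal⁻¹) := by gcongr
    _ = _ := by
      rw [Real.mul_rpow (by norm_num) (by linarith)]
      ring

variable [OpensMeasurableSpace X]

/-- The contribution of the double of the ball to the composition of two local estimates, given
by `near`, dominates, because the contributions of the dyadic annuli are summable. -/
theorem LocEst.sq_of_near (hD : IsDoublingWith μ D)
    (hcont : ∀ t : ℝ, 0 < t → BallContinuous F (T t)) (hp : 1 ≤ p) (hr : 1 ≤ r) (hpr : p ≤ r)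
    {c₁ c₂ c δ : ℝ} (hc₁ : 0 < c₁) (hc₂ : 0 < c₂) (hc : c ≤ (c₁ + c₂) / 2)
    (h₁ : LocEst F T p q (1 / 4) c₁) (h₂ : LocEst F T q r (1 / 4) c₂)
    (near : ∃ N C : ℝ, 0 ≤ N ∧ 0 < C ∧ ∀ t : ℝ, 0 < t → ∀ (x : X) (R : ℝ), 0 < R →
      ∀ A₁ A₂ : Set X, MeasurableSet A₁ → MeasurableSet A₂ → A₁ ⊆ Metric.ball x R →
        A₂ ⊆ Metric.ball x R → (∀ a ∈ A₁, ∀ b ∈ A₂, δ * R ≤ dist a b) → ∀ f : E,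
        eLpNorm (F.toFn (T t (F.trunc (Metric.ball x (2 * R)) (T t (F.trunc A₁ f))))) r
            (μ.restrict A₂)
          ≤ ENNReal.ofReal (C * dec (R / √t) ^ N * Real.exp (-(c * (R / √t) ^ 2))
              * μ.real (Metric.ball x R) ^ (r.toReal⁻¹ - p.toReal⁻¹))
            * eLpNorm (F.toFn f) p (μ.restrict A₁)) :
    LocEst F (fun t => (T t).comp (T t)) p r δ c := by
  obtain ⟨N₀, C₀, hN₀, hC₀, H₀⟩ := near
  obtain ⟨N, C, hN, hC, H⟩ := h₁.two_step hD h₂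
  obtain ⟨K, hK, hKs⟩ := exists_dec_mul_exp_le hN (add_pos hc₁ hc₂)
  refine ⟨N₀ + (2 * N + 1), C₀ + C * K * 2, by positivity, by positivity,
    fun t ht x R hR A₁ A₂ hA₁ hA₂ hB₁ hB₂ hsep f => ?_⟩
  have hs : 0 < R / √t := div_pos hR (Real.sqrt_pos.2 ht)
  set s := R / √t with hsdef
  have hd := one_le_dec hs
  have hV := hD.real_pos x hR
  set V := μ.real (Metric.ball x R) with hVdef
  set e := r.toReal⁻¹ - p.toReal⁻¹ with he
  have he0 : e ≤ 0 := sub_nonpos.2 (toReal_inv_anti hp hpr)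
  set Λ := eLpNorm (F.toFn f) p (μ.restrict A₁) with hΛ
  set u := T t (F.trunc A₁ f) with hu
  set W : ℝ := dec s ^ (2 * N + 1) * Real.exp (-(c * s ^ 2)) * V ^ e with hW
  have hW0 : 0 < W := by positivity
  have hlim := (hcont t ht).tendstoInMeasure_dyadic u x hR hB₂
  have hstep := fun n : ℕ => F.trunc_ball_sub_trunc_ball x hR (n + 1) u
  have hbase := H₀ t ht x R hR A₁ A₂ hA₁ hA₂ hB₁ hB₂ hsep f
  have hterm : ∀ n : ℕ, eLpNorm (F.toFn (T t (F.trunc (Metric.ball x (2 ^ (n + 1 + 1) * R)) u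
      - F.trunc (Metric.ball x (2 ^ (n + 1) * R)) u))) r (μ.restrict A₂)
        ≤ ENNReal.ofReal (C * K * W * (1 / 2) ^ n) * Λ := by
    intro n
    rw [hstep]
    have hpow : (2 : ℝ) ≤ 2 ^ (n + 1) := by
      calc (2 : ℝ) = 2 ^ 1 := by norm_num
        _ ≤ 2 ^ (n + 1) := pow_le_pow_right₀ (by norm_num) (by omega)
    have hpow2 : (2 : ℝ) ^ (n + 2) = 2 * 2 ^ (n + 1) := by ring
    have hR' : 0 < 2 ^ (n + 2) * R := by positivity
    have hBR : Metric.ball x R ⊆ Metric.ball x (2 ^ (n + 2) * R) :=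
      Metric.ball_subset_ball (by rw [hpow2]; nlinarith)
    have hdist : ∀ a ∈ Metric.ball x R, ∀ b ∈ annulus x R (n + 1),
        1 / 4 * (2 ^ (n + 2) * R) ≤ dist a b := by
      intro a ha b hb
      have h1 := (mem_annulus.1 hb).1
      have h2 : dist a x < R := ha
      have h3 := dist_triangle_left b x a
      rw [hpow2]
      nlinarith
    refine (H t ht x _ hR' A₁ (annulus x R (n + 1)) A₂ hA₁ (measurableSet_annulus _ _ _) hA₂
      (hB₁.trans hBR) Set.sdiff_subset (hB₂.trans hBR) (fun a ha b hb => hdist a (hB₁ ha) b hb)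
      (fun a ha b hb => by rw [dist_comm]; exact hdist b (hB₂ hb) a ha) f).trans ?_
    gcongr ENNReal.ofReal ?_ * _
    have hVR : μ.real (Metric.ball x (2 ^ (n + 2) * R)) ^ e ≤ V ^ e :=
      Real.rpow_le_rpow_of_nonpos hV (hD.real_mono (by rw [dist_self, hpow2]; nlinarith)) he0
    have hk := hKs s hs n
    have hes : 2 ^ (n + 2) * R / √t = 2 ^ (n + 2) * s := by rw [hsdef]; ring
    rw [hes]
    have hexp : Real.exp (-((c₁ + c₂) / 2 * s ^ 2)) ≤ Real.exp (-(c * s ^ 2)) := by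
      apply Real.exp_le_exp.2
      have : c * s ^ 2 ≤ (c₁ + c₂) / 2 * s ^ 2 := by gcongr
      linarith
    calc _ ≤ C * (K * (1 / 2) ^ n * dec s ^ (2 * N + 1) * Real.exp (-((c₁ + c₂) / 2 * s ^ 2)))
          * V ^ e := by gcongr
      _ ≤ C * (K * (1 / 2) ^ n * dec s ^ (2 * N + 1) * Real.exp (-(c * s ^ 2))) * V ^ e := by
          gcongr
      _ = _ := by rw [hW]; ring
  have key := F.eLpNorm_le_add_tsum (T t) hr hlim (by simpa using hbase) hterm
  rw [ContinuousLinearMap.comp_apply]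
  refine key.trans ?_
  rw [ENNReal.tsum_mul_right, ← ENNReal.ofReal_tsum_of_nonneg (fun n => by positivity)
    (summable_geometric_two.mul_left _), tsum_mul_left, tsum_geometric_two, ← add_mul,
    ← ENNReal.ofReal_add (by positivity) (by positivity)]
  gcongr ENNReal.ofReal ?_ * _
  have h1 : dec s ^ N₀ ≤ dec s ^ (N₀ + (2 * N + 1)) :=
    Real.rpow_le_rpow_of_exponent_le hd (by linarith)
  have h2 : dec s ^ (2 * N + 1) ≤ dec s ^ (N₀ + (2 * N + 1)) :=
    Real.rpow_le_rpow_of_exponent_le hd (by linarith)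
  calc _ ≤ C₀ * dec s ^ (N₀ + (2 * N + 1)) * Real.exp (-(c * s ^ 2)) * V ^ e
        + C * K * (dec s ^ (N₀ + (2 * N + 1)) * Real.exp (-(c * s ^ 2)) * V ^ e) * 2 := by
        rw [hW]
        gcongr
    _ = _ := by ring

/-- Transitivity of local estimates for a semigroup. -/
theorem Loc.trans (hD : IsDoublingWith μ D)
    (hT : ∀ s t : ℝ, 0 < s → 0 < t → (T s).comp (T t) = T (s + t))
    (hcont : ∀ t : ℝ, 0 < t → BallContinuous F (T t)) (hp : 1 ≤ p) (hpq : p ≤ q) (hqr : q ≤ r)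
    (h₁ : Loc F T p q) (h₂ : Loc F T q r) : Loc F T p r := by
  have hr : 1 ≤ r := hp.trans (hpq.trans hqr)
  have hpr : p ≤ r := hpq.trans hqr
  obtain ⟨c₁, hc₁, H₁⟩ := h₁.2 (1 / 4) (by norm_num)
  obtain ⟨c₂, hc₂, H₂⟩ := h₂.2 (1 / 4) (by norm_num)
  have he0 : r.toReal⁻¹ - p.toReal⁻¹ ≤ 0 := sub_nonpos.2 (toReal_inv_anti hp hpr)
  -- passing from the double of the ball back to the ball
  have hkernel : ∀ {N C c : ℝ}, 0 ≤ N → 0 < C → 0 ≤ c → ∀ {t : ℝ}, 0 < t → ∀ (x : X) {R : ℝ},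
      0 < R → C * (dec (2 * R / √t) ^ N * Real.exp (-(c * (2 * R / √t) ^ 2)))
        * μ.real (Metric.ball x (2 * R)) ^ (r.toReal⁻¹ - p.toReal⁻¹)
      ≤ C * 2 ^ N * dec (R / √t) ^ N * Real.exp (-(c * (R / √t) ^ 2))
        * μ.real (Metric.ball x R) ^ (r.toReal⁻¹ - p.toReal⁻¹) := by
    intro N C c hN hC hc t ht x R hR
    have hs : 0 < R / √t := div_pos hR (Real.sqrt_pos.2 ht)
    have hd := one_le_dec hs
    have hV := hD.real_pos x hR
    have hVR : μ.real (Metric.ball x (2 * R)) ^ (r.toReal⁻¹ - p.toReal⁻¹)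
        ≤ μ.real (Metric.ball x R) ^ (r.toReal⁻¹ - p.toReal⁻¹) :=
      Real.rpow_le_rpow_of_nonpos hV (hD.real_mono (by rw [dist_self]; linarith)) he0
    have e : 2 * R / √t = 2 ^ 1 * (R / √t) := by ring
    rw [e]
    have h2 := dec_two_pow_mul_le 1 hs
    have h3 : Real.exp (-(c * (2 ^ 1 * (R / √t)) ^ 2)) ≤ Real.exp (-(c * (R / √t) ^ 2)) := by
      apply Real.exp_le_exp.2
      rw [neg_le_neg_iff]
      gcongr
      linarith
    have hd' : 0 ≤ dec (2 ^ 1 * (R / √t)) := zero_le_one.trans (one_le_dec (by positivity))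
    calc _ ≤ C * ((2 ^ 1 * dec (R / √t)) ^ N * Real.exp (-(c * (R / √t) ^ 2)))
          * μ.real (Metric.ball x R) ^ (r.toReal⁻¹ - p.toReal⁻¹) := by gcongr
      _ = _ := by
        rw [Real.mul_rpow (by norm_num) (by linarith), pow_one]
        ring
  have hdouble : ∀ (x : X) {R : ℝ}, 0 < R → Metric.ball x R ⊆ Metric.ball x (2 * R) :=
    fun x R hR => Metric.ball_subset_ball (by linarith)
  constructor
  · refine LocEst.of_sq le_rfl (LocEst.sq_of_near hD hcont hp hr hpr hc₁ hc₂ (by positivity) H₁ H₂ ?_) hT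
    obtain ⟨N, C, hN, hC, H⟩ := h₁.1.two_step hD h₂.1
    refine ⟨N, C * 2 ^ N, hN, by positivity, fun t ht x R hR A₁ A₂ hA₁ hA₂ hB₁ hB₂ _ f => ?_⟩
    refine (H t ht x (2 * R) (by positivity) A₁ (Metric.ball x (2 * R)) A₂ hA₁ measurableSet_ball
      hA₂ (hB₁.trans (hdouble x hR)) le_rfl (hB₂.trans (hdouble x hR)) (fun a _ b _ => by simp)
      (fun a _ b _ => by simp) f).trans ?_
    gcongr ENNReal.ofReal ?_ * _
    rw [add_zero]
    exact hkernel hN hC le_rfl ht x hR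
  · intro δ hδ
    obtain ⟨a₁, ha₁, G₁⟩ := h₁.2 (δ / 4) (by positivity)
    obtain ⟨a₂, ha₂, G₂⟩ := h₂.2 (δ / 4) (by positivity)
    set c := min ((c₁ + c₂) / 2) (min a₁ a₂) with hc
    have hc0 : 0 < c := by positivity
    have hca₁ : c ≤ a₁ := (min_le_right _ _).trans (min_le_left _ _)
    have hca₂ : c ≤ a₂ := (min_le_right _ _).trans (min_le_right _ _)
    refine ⟨c, hc0, LocEst.of_sq hc0.le
      (LocEst.sq_of_near hD hcont hp hr hpr hc₁ hc₂ (min_le_left _ _) H₁ H₂ ?_) hT⟩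
    obtain ⟨N, C, hN, hC, H⟩ := G₁.two_step hD h₂.1
    obtain ⟨N', C', hN', hC', H'⟩ := h₁.1.two_step hD G₂
    refine ⟨N + N', C * 2 ^ N + C' * 2 ^ N', by positivity, by positivity,
      fun t ht x R hR A₁ A₂ hA₁ hA₂ hB₁ hB₂ hsep f => ?_⟩
    have hs : 0 < R / √t := div_pos hR (Real.sqrt_pos.2 ht)
    have hd := one_le_dec hs
    -- the points of the double ball close to `A₁` are far from `A₂`
    set U := Metric.thickening (δ / 2 * R) A₁ with hU
    have hUm : MeasurableSet U := Metric.isOpen_thickening.measurableSet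
    set B := Metric.ball x (2 * R) with hB
    have hBm : MeasurableSet B := measurableSet_ball
    have e : F.trunc B (T t (F.trunc A₁ f))
        = F.trunc (B \ U) (T t (F.trunc A₁ f)) + F.trunc (B ∩ U) (T t (F.trunc A₁ f)) := by
      rw [← F.trunc_union (hBm.diff hUm) (hBm.inter hUm) Set.disjoint_sdiff_inter,
        Set.sdiff_union_inter]
    have k1 := H t ht x (2 * R) (by positivity) A₁ (B \ U) A₂ hA₁ (hBm.diff hUm)
      hA₂ (hB₁.trans (hdouble x hR)) Set.sdiff_subset (hB₂.trans (hdouble x hR))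
      (fun a ha b hb => by
        have h1 := hb.2
        rw [hU, Metric.mem_thickening_iff] at h1
        push Not at h1
        have h2 := h1 a ha
        rw [dist_comm a b]
        linarith) (fun a _ b _ => by simp) f
    have k2 := H' t ht x (2 * R) (by positivity) A₁ (B ∩ U) A₂ hA₁ (hBm.inter hUm)
      hA₂ (hB₁.trans (hdouble x hR)) Set.inter_subset_left (hB₂.trans (hdouble x hR))
      (fun a _ b _ => by simp) (fun y hy b hb => by
        have h1 := hy.2
        rw [hU, Metric.mem_thickening_iff] at h1
        obtain ⟨a, ha, hya⟩ := h1
        have h2 := hsep a ha b hb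
        have h3 := dist_triangle_left a b y
        linarith) f
    rw [e, map_add]
    refine (F.eLpNorm_toFn_add_le _ _ hr _).trans ((add_le_add k1 k2).trans ?_)
    have hV := hD.real_pos x hR
    have hd2 : 0 < dec (2 * R / √t) := zero_lt_one.trans_le (one_le_dec (by positivity))
    rw [add_zero, zero_add, ← add_mul, ← ENNReal.ofReal_add (by positivity) (by positivity)]
    gcongr ENNReal.ofReal ?_ * _
    refine (add_le_add (hkernel hN hC ha₁.le ht x hR) (hkernel hN' hC' ha₂.le ht x hR)).trans ?_
    have hx1 : Real.exp (-(a₁ * (R / √t) ^ 2)) ≤ Real.exp (-(c * (R / √t) ^ 2)) := by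
      apply Real.exp_le_exp.2
      rw [neg_le_neg_iff]
      gcongr
    have hx2 : Real.exp (-(a₂ * (R / √t) ^ 2)) ≤ Real.exp (-(c * (R / √t) ^ 2)) := by
      apply Real.exp_le_exp.2
      rw [neg_le_neg_iff]
      gcongr
    have hy1 : dec (R / √t) ^ N ≤ dec (R / √t) ^ (N + N') :=
      Real.rpow_le_rpow_of_exponent_le hd (by linarith)
    have hy2 : dec (R / √t) ^ N' ≤ dec (R / √t) ^ (N + N') :=
      Real.rpow_le_rpow_of_exponent_le hd (by linarith)
    rw [add_mul, add_mul, add_mul]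
    gcongr

end

/-! ### Uniform boundedness on `L^p` -/

/-- A substitute for Minkowski's inequality: with geometric room the sum is at most twice the
largest of the `2^n c n`. -/
theorem tsum_rpow_le {c : ℕ → ℝ≥0∞} {a : ℝ} (ha : 0 < a) :
    (∑' n, c n) ^ a ≤ 2 ^ a * ∑' n, (2 ^ n * c n) ^ a := by
  set S := ∑' n, (2 ^ n * c n) ^ a with hS
  have h1 : ∀ n, c n ≤ S ^ a⁻¹ * (2⁻¹) ^ n := by
    intro n
    have h2 : 2 ^ n * c n ≤ S ^ a⁻¹ := by
      rw [ENNReal.le_rpow_inv_iff ha]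
      exact ENNReal.le_tsum n
    have h3 : (2⁻¹ : ℝ≥0∞) ^ n * (2 ^ n * c n) = c n := by
      rw [← mul_assoc, ← mul_pow, ENNReal.inv_mul_cancel (by norm_num) (by norm_num), one_pow,
        one_mul]
    rw [← h3, mul_comm (S ^ a⁻¹)]
    gcongr
  have h4 : ∑' n, c n ≤ S ^ a⁻¹ * 2 := by
    refine (ENNReal.tsum_le_tsum h1).trans_eq ?_
    rw [ENNReal.tsum_mul_left, ENNReal.tsum_geometric, ENNReal.one_sub_inv_two, inv_inv]
  calc _ ≤ (S ^ a⁻¹ * 2) ^ a := by gcongr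
    _ = _ := by
      rw [ENNReal.mul_rpow_of_nonneg _ _ ha.le, ← ENNReal.rpow_mul, inv_mul_cancel₀ ha.ne',
        ENNReal.rpow_one, mul_comm]

theorem eLpNorm_rpow_toReal {X G : Type*} [MeasurableSpace X] {ν : Measure X}
    [NormedAddCommGroup G] {p : ℝ≥0∞} (hp : 1 ≤ p) (hp' : p ≠ ∞) (f : X → G) :
    eLpNorm f p ν ^ p.toReal = ∫⁻ x, ‖f x‖ₑ ^ p.toReal ∂ν := by
  have hp0 : 0 < p.toReal := ENNReal.toReal_pos (zero_lt_one.trans_le hp).ne' hp'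
  rw [eLpNorm_eq_lintegral_rpow_enorm_toReal (zero_lt_one.trans_le hp).ne' hp', one_div,
    ← ENNReal.rpow_mul, inv_mul_cancel₀ hp0.ne', ENNReal.rpow_one]

section

variable {X : Type*} [MetricSpace X] [MeasurableSpace X] [OpensMeasurableSpace X]
  {μ : Measure X} {D : ℝ}

namespace IsDoublingWith

variable (hD : IsDoublingWith μ D)
include hD

theorem countable_of_separated {ε : ℝ} (hε : 0 < ε) {Y : Set X}
    (hsep : ∀ y ∈ Y, ∀ z ∈ Y, y ≠ z → ε ≤ dist y z) : Y.Countable := by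
  rcases Y.eq_empty_or_nonempty with rfl | ⟨x, -⟩
  · exact Set.countable_empty
  have h : Y = ⋃ m : ℕ, Y ∩ Metric.ball x (2 ^ m * ε) := by
    rw [← Set.inter_iUnion, eq_comm, Set.inter_eq_left]
    intro y _
    obtain ⟨n, hn⟩ := pow_unbounded_of_one_lt (dist y x / ε) one_lt_two
    exact Set.mem_iUnion.2 ⟨n, by rwa [Metric.mem_ball, ← div_lt_iff₀ hε]⟩
  rw [h]
  exact Set.countable_iUnion fun m => (hD.finite_of_separated hε x m
    (fun y hy z hz => hsep y hy.1 z hz.1) fun y hy => hy.2).countable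

/-- Bounded overlap of balls centered in a separated set. -/
theorem tsum_setLIntegral_ball_le {ε : ℝ} (hε : 0 < ε) {Y : Set X}
    (hsep : ∀ y ∈ Y, ∀ z ∈ Y, y ≠ z → ε ≤ dist y z) (m : ℕ) {g : X → ℝ≥0∞} (hg : Measurable g) :
    ∑' y : Y, ∫⁻ z in Metric.ball (y : X) (2 ^ m * ε), g z ∂μ
      ≤ ENNReal.ofReal (D ^ (m + 3)) * ∫⁻ z, g z ∂μ := by
  have hD0 := hD.pos'
  have : Countable Y := (hD.countable_of_separated hε hsep).to_subtype
  have hpt : ∀ z, ∑' y : Y, (Metric.ball (y : X) (2 ^ m * ε)).indicator g z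
      ≤ ENNReal.ofReal (D ^ (m + 3)) * g z := by
    intro z
    rw [ENNReal.tsum_eq_iSup_sum]
    refine iSup_le fun s => ?_
    classical
    simp only [Set.indicator_apply]
    rw [← Finset.sum_filter, Finset.sum_const, nsmul_eq_mul]
    gcongr
    have hc := hD.card_le hε z m ((Finset.filter (fun y : Y => z ∈ Metric.ball (y : X) (2 ^ m * ε)) s).map
      (Function.Embedding.subtype _)) (by
        simp only [Finset.mem_map, Function.Embedding.subtype_apply]
        rintro _ ⟨y, -, rfl⟩ _ ⟨w, -, rfl⟩ hyw
        exact hsep _ y.2 _ w.2 hyw) (by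
        simp only [Finset.mem_map, Finset.mem_filter, Function.Embedding.subtype_apply]
        rintro _ ⟨y, ⟨-, hy⟩, rfl⟩
        rw [dist_comm]
        exact hy)
    rw [Finset.card_map] at hc
    rw [← ENNReal.ofReal_natCast]
    exact ENNReal.ofReal_le_ofReal hc
  calc _ = ∑' y : Y, ∫⁻ z, (Metric.ball (y : X) (2 ^ m * ε)).indicator g z ∂μ := by
        simp only [lintegral_indicator measurableSet_ball]
    _ = ∫⁻ z, ∑' y : Y, (Metric.ball (y : X) (2 ^ m * ε)).indicator g z ∂μ :=
        (lintegral_tsum fun y => (hg.indicator measurableSet_ball).aemeasurable).symm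
    _ ≤ ∫⁻ z, ENNReal.ofReal (D ^ (m + 3)) * g z ∂μ := lintegral_mono hpt
    _ = _ := lintegral_const_mul _ hg

end IsDoublingWith

variable {𝕜 : Type*} [RCLike 𝕜] {E : Type*} [NormedAddCommGroup E] [NormedSpace 𝕜 E]
  {F : FunctionSpace 𝕜 μ E} {T : ℝ → E →L[𝕜] E} {p : ℝ≥0∞}

/-- On a ball of radius `√t`, the function `T t f` is controlled by `f` on the concentric balls,
with coefficients decaying faster than any prescribed geometric rate. -/
theorem Loc.eLpNorm_ball_le (hcont : ∀ t : ℝ, 0 < t → BallContinuous F (T t))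
    (hp : 1 ≤ p) (h : Loc F T p p) (L : ℕ) :
    ∃ Q : ℝ, 0 < Q ∧ ∀ t : ℝ, 0 < t → ∀ (x : X) (f : E),
      eLpNorm (F.toFn (T t f)) p (μ.restrict (Metric.ball x √t))
        ≤ ∑' n : ℕ, ENNReal.ofReal (Q * ((2 ^ L)⁻¹) ^ n)
          * eLpNorm (F.toFn f) p (μ.restrict (Metric.ball x (2 ^ (n + 1) * √t))) := by
  obtain ⟨⟨N₀, C₀, hN₀, hC₀, H₀⟩, hsep⟩ := h
  obtain ⟨c, hc, N, C, hN, hC, H⟩ := hsep (1 / 4) (by norm_num)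
  obtain ⟨K, hK, hKy⟩ := exists_rpow_mul_exp_le (N + L) hc
  refine ⟨C₀ * 2 ^ N₀ + C * K * 2 ^ L, by positivity, fun t ht x f => ?_⟩
  have hR : 0 < √t := Real.sqrt_pos.2 ht
  set R := √t with hRdef
  have hlim := (hcont t ht).tendstoInMeasure_dyadic f x hR le_rfl
  have hstep := fun n : ℕ => F.trunc_ball_sub_trunc_ball x hR (n + 1) f
  have hdec2 : ∀ n : ℕ, dec (2 ^ n * R / √t) = 2 ^ n := by
    intro n
    rw [← hRdef, mul_div_assoc, div_self hR.ne', mul_one]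
    have : (1 : ℝ) ≤ 2 ^ n := one_le_pow₀ (by norm_num)
    exact max_eq_left ((inv_le_one_of_one_le₀ this).trans this)
  have hdiv : ∀ n : ℕ, 2 ^ n * R / √t = 2 ^ n := by
    intro n
    rw [← hRdef, mul_div_assoc, div_self hR.ne', mul_one]
  have hbase : eLpNorm (F.toFn (T t (F.trunc (Metric.ball x (2 ^ (0 + 1) * R)) f))) p
      (μ.restrict (Metric.ball x R)) ≤ ENNReal.ofReal (C₀ * 2 ^ N₀)
        * eLpNorm (F.toFn f) p (μ.restrict (Metric.ball x (2 ^ (0 + 1) * R))) := by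
    have h1 := H₀ t ht x (2 ^ (0 + 1) * R) (by positivity) (Metric.ball x (2 ^ (0 + 1) * R))
      (Metric.ball x R) measurableSet_ball measurableSet_ball le_rfl
      (Metric.ball_subset_ball (by rw [zero_add, pow_one]; linarith)) (fun a _ b _ => by simp) f
    rw [hdec2] at h1
    simpa using h1
  have hterm : ∀ n : ℕ, eLpNorm (F.toFn (T t (F.trunc (Metric.ball x (2 ^ (n + 1 + 1) * R)) f
      - F.trunc (Metric.ball x (2 ^ (n + 1) * R)) f))) p (μ.restrict (Metric.ball x R))
        ≤ ENNReal.ofReal (C * K * ((2 ^ L)⁻¹) ^ n)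
          * eLpNorm (F.toFn f) p (μ.restrict (Metric.ball x (2 ^ (n + 1 + 1) * R))) := by
    intro n
    rw [hstep]
    have hpow : (2 : ℝ) ≤ 2 ^ (n + 1) := by
      calc (2 : ℝ) = 2 ^ 1 := by norm_num
        _ ≤ 2 ^ (n + 1) := pow_le_pow_right₀ (by norm_num) (by omega)
    have hpow2 : (2 : ℝ) ^ (n + 1 + 1) = 2 * 2 ^ (n + 1) := by ring
    have h1 := H t ht x (2 ^ (n + 1 + 1) * R) (by positivity) (annulus x R (n + 1))
      (Metric.ball x R) (measurableSet_annulus _ _ _) measurableSet_ball Set.sdiff_subset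
      (Metric.ball_subset_ball (by rw [hpow2]; nlinarith)) (fun b hb a ha => by
        have h1 := (mem_annulus.1 hb).1
        have h2 : dist a x < R := ha
        have h3 := dist_triangle b a x
        rw [hpow2]
        nlinarith) f
    refine h1.trans (mul_le_mul' (ENNReal.ofReal_le_ofReal ?_) (eLpNorm_mono_measure _
      (Measure.restrict_mono Set.sdiff_subset le_rfl)))
    rw [hdec2, hdiv, sub_self, Real.rpow_zero, mul_one, mul_assoc, mul_assoc]
    refine mul_le_mul_of_nonneg_left ?_ hC.le
    set P : ℝ := 2 ^ (n + 1 + 1) with hP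
    have hP0 : 0 < P := by positivity
    have h2 := hKy P hP0 (by positivity)
    rw [Real.rpow_add hP0, Real.rpow_natCast] at h2
    have h3 : (2 ^ L) ^ n ≤ P ^ L := by
      rw [hP, ← pow_mul, ← pow_mul]
      exact pow_le_pow_right₀ (by norm_num) (by nlinarith)
    rw [inv_pow, ← div_eq_mul_inv, le_div_iff₀ (by positivity)]
    calc _ ≤ P ^ N * Real.exp (-(c * P ^ 2)) * P ^ L := by gcongr
      _ ≤ K := by linarith
  refine (F.eLpNorm_le_add_tsum (T t) hp hlim hbase hterm).trans ?_
  rw [tsum_eq_zero_add' (f := fun n : ℕ => ENNReal.ofReal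
    ((C₀ * 2 ^ N₀ + C * K * 2 ^ L) * ((2 ^ L)⁻¹) ^ n)
      * eLpNorm (F.toFn f) p (μ.restrict (Metric.ball x (2 ^ (n + 1) * R)))) ENNReal.summable]
  have h5 : 0 < C₀ * 2 ^ N₀ := by positivity
  have h6 : 0 < C * K * 2 ^ L := by positivity
  refine add_le_add (mul_le_mul_left (ENNReal.ofReal_le_ofReal ?_) _)
    (ENNReal.tsum_le_tsum fun n => mul_le_mul_left (ENNReal.ofReal_le_ofReal ?_) _)
  · rw [pow_zero, mul_one]
    linarith
  · rw [pow_succ', ← mul_assoc]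
    refine mul_le_mul_of_nonneg_right ?_ (by positivity)
    rw [← div_eq_mul_inv, le_div_iff₀ (by positivity)]
    linarith

theorem Loc.mem_boundedExponents (hD : IsDoublingWith μ D)
    (hcont : ∀ t : ℝ, 0 < t → BallContinuous F (T t)) (hp : 1 ≤ p) (h : Loc F T p p) :
    p ∈ boundedExponents F T := by
  refine ⟨hp, ?_⟩
  have hD0 := hD.pos'
  have hD1 := hD.one_le
  have hnet : ∀ t : ℝ, 0 < t → ∃ Y : Set X, (∀ y ∈ Y, ∀ z ∈ Y, y ≠ z → √t ≤ dist y z) ∧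
      Y.Countable ∧ ⋃ y : Y, Metric.ball (y : X) √t = Set.univ := by
    intro t ht
    have hR := Real.sqrt_pos.2 ht
    obtain ⟨Y, -, hsep, hcov⟩ := exists_separated_net (Set.univ : Set X) √t
    refine ⟨Y, hsep, hD.countable_of_separated hR hsep, Set.eq_univ_of_forall fun x => ?_⟩
    by_cases hx : x ∈ Y
    · exact Set.mem_iUnion.2 ⟨⟨x, hx⟩, Metric.mem_ball_self hR⟩
    · obtain ⟨y, hy, hxy⟩ := hcov x (Set.mem_univ _) hx
      exact Set.mem_iUnion.2 ⟨⟨y, hy⟩, hxy⟩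
  rcases eq_or_ne p ∞ with rfl | hp'
  · obtain ⟨Q, hQ, H⟩ := h.eLpNorm_ball_le hcont hp 1
    refine ⟨(Q * 2).toNNReal, fun t ht f _ => ?_⟩
    obtain ⟨Y, -, hYc, hcov⟩ := hnet t ht
    have : Countable Y := hYc.to_subtype
    have hloc : ∀ y : Y, eLpNorm (F.toFn (T t f)) ∞ (μ.restrict (Metric.ball (y : X) √t))
        ≤ (Q * 2).toNNReal * eLpNorm (F.toFn f) ∞ μ := by
      intro y
      refine (H t ht y f).trans ?_
      calc _ ≤ ∑' n : ℕ, ENNReal.ofReal (Q * (1 / 2) ^ n) * eLpNorm (F.toFn f) ∞ μ := by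
            gcongr with n
            · norm_num
            · exact Measure.restrict_le_self
        _ = _ := by
            rw [ENNReal.tsum_mul_right, ← ENNReal.ofReal_tsum_of_nonneg (fun n => by positivity)
              (summable_geometric_two.mul_left _), tsum_mul_left, tsum_geometric_two]
            rfl
    rw [eLpNorm_exponent_top, eLpNormEssSup]
    refine essSup_le_of_ae_le _ ?_
    have hae : ∀ᵐ x ∂μ.restrict (⋃ y : Y, Metric.ball (y : X) √t),
        ‖(F.toFn (T t f) : X → 𝕜) x‖ₑ ≤ (Q * 2).toNNReal * eLpNorm (F.toFn f) ∞ μ := by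
      rw [ae_restrict_iUnion_iff]
      intro y
      have h1 := hloc y
      rw [eLpNorm_exponent_top, eLpNormEssSup] at h1
      exact (ENNReal.ae_le_essSup (fun x => ‖(F.toFn (T t f) : X → 𝕜) x‖ₑ)).mono fun x hx => hx.trans h1
    rwa [hcov, Measure.restrict_univ] at hae
  · have hp0 : 0 < p.toReal := ENNReal.toReal_pos (zero_lt_one.trans_le hp).ne' hp'
    have hp1 : 1 ≤ p.toReal := by
      simpa using ENNReal.toReal_mono hp' hp
    obtain ⟨L, hL⟩ := pow_unbounded_of_one_lt (4 * D) (one_lt_two (α := ℝ))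
    obtain ⟨Q, hQ, H⟩ := h.eLpNorm_ball_le hcont hp L
    set M : ℝ := 2 ^ p.toReal * (Q ^ p.toReal * D ^ 4 * 2) with hM
    have hM0 : 0 < M := by positivity
    refine ⟨(M ^ p.toReal⁻¹).toNNReal, fun t ht f _ => ?_⟩
    have hR := Real.sqrt_pos.2 ht
    obtain ⟨Y, hsep, hYc, hcov⟩ := hnet t ht
    have : Countable Y := hYc.to_subtype
    set g : X → ℝ≥0∞ := fun x => ‖(F.toFn f : X → 𝕜) x‖ₑ ^ p.toReal with hg
    have hgm : Measurable g :=
      (AEEqFun.stronglyMeasurable (F.toFn f)).measurable.enorm.pow_const _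
    have hcoef : ∀ n : ℕ, (2 ^ n * ENNReal.ofReal (Q * ((2 ^ L)⁻¹) ^ n)) ^ p.toReal
        * ENNReal.ofReal (D ^ (n + 1 + 3)) ≤ ENNReal.ofReal (Q ^ p.toReal * D ^ 4 * (1 / 2) ^ n) := by
      intro n
      have e2 : (2 : ℝ≥0∞) ^ n = ENNReal.ofReal (2 ^ n) := by
        rw [ENNReal.ofReal_pow (by norm_num)]; simp
      rw [e2, ← ENNReal.ofReal_mul (by positivity),
        ENNReal.ofReal_rpow_of_nonneg (by positivity) hp0.le, ← ENNReal.ofReal_mul (by positivity)]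
      apply ENNReal.ofReal_le_ofReal
      have hκ : 2 * (2 ^ L)⁻¹ ≤ (1 : ℝ) := by
        rw [← div_eq_mul_inv, div_le_one (by positivity)]
        linarith
      have hκD : 2 * (2 ^ L)⁻¹ * D ≤ 1 / 2 := by
        rw [← div_eq_mul_inv, div_mul_eq_mul_div, div_le_iff₀ (by positivity)]
        linarith
      have e3 : 2 ^ n * (Q * ((2 ^ L)⁻¹) ^ n) = Q * (2 * (2 ^ L)⁻¹) ^ n := by
        rw [mul_pow]; ring
      rw [e3, Real.mul_rpow hQ.le (by positivity)]
      have h1 : ((2 * (2 ^ L)⁻¹ : ℝ) ^ n) ^ p.toReal ≤ (2 * (2 ^ L)⁻¹) ^ n := by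
        have := Real.rpow_le_rpow_of_exponent_ge (x := (2 * (2 ^ L)⁻¹ : ℝ) ^ n) (by positivity)
          (pow_le_one₀ (by positivity) hκ) hp1
        rwa [Real.rpow_one] at this
      calc _ ≤ Q ^ p.toReal * (2 * (2 ^ L)⁻¹) ^ n * D ^ (n + 1 + 3) := by gcongr
        _ = Q ^ p.toReal * D ^ 4 * (2 * (2 ^ L)⁻¹ * D) ^ n := by rw [mul_pow]; ring
        _ ≤ _ := by gcongr
    have hmain : ∫⁻ x, ‖(F.toFn (T t f) : X → 𝕜) x‖ₑ ^ p.toReal ∂μ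
        ≤ ENNReal.ofReal M * ∫⁻ x, g x ∂μ := by
      calc _ = ∫⁻ x in ⋃ y : Y, Metric.ball (y : X) √t,
            ‖(F.toFn (T t f) : X → 𝕜) x‖ₑ ^ p.toReal ∂μ := by
            rw [hcov, Measure.restrict_univ]
        _ ≤ ∑' y : Y, ∫⁻ x in Metric.ball (y : X) √t,
            ‖(F.toFn (T t f) : X → 𝕜) x‖ₑ ^ p.toReal ∂μ := lintegral_iUnion_le _ _
        _ ≤ ∑' y : Y, 2 ^ p.toReal * ∑' n : ℕ,
            (2 ^ n * ENNReal.ofReal (Q * ((2 ^ L)⁻¹) ^ n)) ^ p.toReal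
              * ∫⁻ x in Metric.ball (y : X) (2 ^ (n + 1) * √t), g x ∂μ := by
            gcongr with y
            rw [← eLpNorm_rpow_toReal hp hp']
            refine (ENNReal.rpow_le_rpow (H t ht y f) hp0.le).trans ?_
            refine (tsum_rpow_le hp0).trans ?_
            gcongr with n
            rw [← mul_assoc, ENNReal.mul_rpow_of_nonneg _ _ hp0.le, eLpNorm_rpow_toReal hp hp']
        _ = 2 ^ p.toReal * ∑' n : ℕ,
            (2 ^ n * ENNReal.ofReal (Q * ((2 ^ L)⁻¹) ^ n)) ^ p.toReal
              * ∑' y : Y, ∫⁻ x in Metric.ball (y : X) (2 ^ (n + 1) * √t), g x ∂μ := by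
            rw [ENNReal.tsum_mul_left, ENNReal.tsum_comm]
            simp only [ENNReal.tsum_mul_left]
        _ ≤ 2 ^ p.toReal * ∑' n : ℕ, ENNReal.ofReal (Q ^ p.toReal * D ^ 4 * (1 / 2) ^ n)
              * ∫⁻ x, g x ∂μ := by
            refine mul_le_mul_right (ENNReal.tsum_le_tsum fun n => ?_) _
            refine (mul_le_mul_right (hD.tsum_setLIntegral_ball_le hR hsep (n + 1) hgm) _).trans ?_
            rw [← mul_assoc]
            gcongr
            exact hcoef n
        _ = _ := by
            have e2 : (2 : ℝ≥0∞) ^ p.toReal = ENNReal.ofReal (2 ^ p.toReal) := by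
              rw [← ENNReal.ofReal_rpow_of_pos (by norm_num)]; simp
            rw [ENNReal.tsum_mul_right, ← ENNReal.ofReal_tsum_of_nonneg (fun n => by positivity)
              (summable_geometric_two.mul_left _), tsum_mul_left, tsum_geometric_two, ← mul_assoc,
              hM, e2, ← ENNReal.ofReal_mul (by positivity)]
    rw [← eLpNorm_rpow_toReal hp hp', hg, ← eLpNorm_rpow_toReal hp hp',
      ← ENNReal.le_rpow_inv_iff hp0, ENNReal.mul_rpow_of_nonneg _ _ (by positivity),
      ← ENNReal.rpow_mul, mul_inv_cancel₀ hp0.ne', ENNReal.rpow_one,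
      ENNReal.ofReal_rpow_of_pos hM0] at hmain
    exact hmain

end

/-! ### The interval of exponents -/

theorem toReal_inv_lt {p q : ℝ≥0∞} (hp : 1 ≤ p) (h : p < q) : q.toReal⁻¹ < p.toReal⁻¹ := by
  rw [← ENNReal.toReal_inv, ← ENNReal.toReal_inv]
  exact (ENNReal.toReal_lt_toReal (inv_ne_top_of_one_le (hp.trans h.le))
    (inv_ne_top_of_one_le hp)).2 (ENNReal.inv_lt_inv.2 h)

/-- The exponent in `[1, ∞]` with a given reciprocal in `[0, 1]`. -/
theorem exists_toReal_inv_eq {b : ℝ} (h0 : 0 ≤ b) (h1 : b ≤ 1) :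
    ∃ s : ℝ≥0∞, 1 ≤ s ∧ s.toReal⁻¹ = b := by
  refine ⟨(ENNReal.ofReal b)⁻¹, ?_, ?_⟩
  · rw [ENNReal.one_le_inv]
    exact ENNReal.ofReal_le_one.2 h1
  · rw [ENNReal.toReal_inv, inv_inv, ENNReal.toReal_ofReal h0]

theorem lt_of_toReal_inv_lt {p q : ℝ≥0∞} (hq : 1 ≤ q) (h : q.toReal⁻¹ < p.toReal⁻¹) : p < q := by
  by_contra! hle
  exact absurd (toReal_inv_anti hq hle) (not_le.2 h)

/-- The interval of exponents attached to a relation `R` on exponents and a set `B` of exponents.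
For the off-diagonal estimates `R p q` and the set `B` of exponents of uniform boundedness, the
hypothesis `interp` is interpolation with a loss in the first exponent. -/
theorem exists_interval (R : ℝ≥0∞ → ℝ≥0∞ → Prop) (B : Set ℝ≥0∞) (hB : ∀ p ∈ B, 1 ≤ p)
    (mono : ∀ p q p' q', 1 ≤ p → p ≤ p' → p' ≤ q' → q' ≤ q → R p q → R p' q')
    (trans : ∀ p q r, 1 ≤ p → p ≤ q → q ≤ r → R p q → R q r → R p r)
    (self : ∀ p, 1 ≤ p → R p p → p ∈ B)
    (interp : ∀ (p₀ q₀ p₁ q₁ r s : ℝ≥0∞) (τ : ℝ), 1 ≤ p₀ → 1 ≤ p₁ → 1 ≤ q₀ → 1 ≤ q₁ → 1 ≤ s →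
      1 ≤ r → r ≠ ∞ → 0 < τ → τ < 1 → s.toReal⁻¹ = (1 - τ) * q₀.toReal⁻¹ + τ * q₁.toReal⁻¹ →
      1 < r.toReal * ((1 - τ) * p₀.toReal⁻¹ + τ * p₁.toReal⁻¹) → R p₀ q₀ →
      (R p₁ q₁ ∨ p₁ = q₁ ∧ p₁ ∈ B) → R r s)
    (p₀ q₀ : ℝ≥0∞) (hp₀ : 1 ≤ p₀) (hpq₀ : p₀ < q₀) (h₀ : R p₀ q₀) :
    ∃ J : Set ℝ≥0∞, (J ⊆ Set.Icc 1 ∞ ∧ ∀ p q, 1 ≤ p → p < q → (R p q ↔ p ∈ J ∧ q ∈ J)) ∧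
      (∀ J' : Set ℝ≥0∞, (J' ⊆ Set.Icc 1 ∞ ∧
        ∀ p q, 1 ≤ p → p < q → (R p q ↔ p ∈ J' ∧ q ∈ J')) → J' = J) ∧
      J.OrdConnected ∧ Set.Icc p₀ q₀ ⊆ J ∧ J ⊆ B ∧ B.OrdConnected ∧ openHull J = openHull B := by
  -- an exponent between two estimates is interior to an interval of estimates
  have hlocal : ∀ p₀ q₀ p₁ q₁ t : ℝ≥0∞, 1 ≤ p₀ → p₀ < q₀ → 1 ≤ p₁ → p₁ ≤ q₁ → 1 ≤ t → R p₀ q₀ →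
      (R p₁ q₁ ∨ p₁ = q₁ ∧ p₁ ∈ B) →
      (p₀.toReal⁻¹ + q₀.toReal⁻¹ < 2 * t.toReal⁻¹ ∧ 2 * t.toReal⁻¹ < p₁.toReal⁻¹ + q₁.toReal⁻¹ ∨
        p₁.toReal⁻¹ + q₁.toReal⁻¹ < 2 * t.toReal⁻¹ ∧
          2 * t.toReal⁻¹ < p₀.toReal⁻¹ + q₀.toReal⁻¹) →
      ∃ r s, 1 ≤ r ∧ r < t ∧ t < s ∧ R r s := by
    intro p₀ q₀ p₁ q₁ t hp₀ hpq₀ hp₁ hpq₁ ht h₀ h₁ hmid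
    have hq₀ : 1 ≤ q₀ := hp₀.trans hpq₀.le
    have hq₁ : 1 ≤ q₁ := hp₁.trans hpq₁
    have i1 := toReal_inv_lt hp₀ hpq₀
    have i2 := toReal_inv_anti hp₁ hpq₁
    have b1 := toReal_inv_le_one hp₀
    have b2 := toReal_inv_le_one hq₀
    have b3 := toReal_inv_le_one hp₁
    have b4 := toReal_inv_le_one hq₁
    have b5 := toReal_inv_le_one ht
    have n1 : 0 ≤ p₀.toReal⁻¹ := by positivity
    have n2 : 0 ≤ q₀.toReal⁻¹ := by positivity
    have n3 : 0 ≤ p₁.toReal⁻¹ := by positivity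
    have n4 : 0 ≤ q₁.toReal⁻¹ := by positivity
    have n5 : 0 ≤ t.toReal⁻¹ := by positivity
    -- `τ` makes `2 / t` the sum of the interpolated reciprocals
    obtain ⟨τ, hτ0, hτ1, hτ⟩ : ∃ τ : ℝ, 0 < τ ∧ τ < 1 ∧
        (1 - τ) * (p₀.toReal⁻¹ + q₀.toReal⁻¹) + τ * (p₁.toReal⁻¹ + q₁.toReal⁻¹)
          = 2 * t.toReal⁻¹ := by
      rcases hmid with ⟨h1, h2⟩ | ⟨h1, h2⟩
      · have hd : 0 < (p₁.toReal⁻¹ + q₁.toReal⁻¹) - (p₀.toReal⁻¹ + q₀.toReal⁻¹) := by linarith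
        refine ⟨(2 * t.toReal⁻¹ - (p₀.toReal⁻¹ + q₀.toReal⁻¹))
          / ((p₁.toReal⁻¹ + q₁.toReal⁻¹) - (p₀.toReal⁻¹ + q₀.toReal⁻¹)),
          div_pos (by linarith) hd, (div_lt_one hd).2 (by linarith), ?_⟩
        generalize p₁.toReal⁻¹ + q₁.toReal⁻¹ = m₁ at *
        generalize p₀.toReal⁻¹ + q₀.toReal⁻¹ = m₀ at *
        field_simp
        ring
      · have hd : 0 < (p₀.toReal⁻¹ + q₀.toReal⁻¹) - (p₁.toReal⁻¹ + q₁.toReal⁻¹) := by linarith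
        refine ⟨((p₀.toReal⁻¹ + q₀.toReal⁻¹) - 2 * t.toReal⁻¹)
          / ((p₀.toReal⁻¹ + q₀.toReal⁻¹) - (p₁.toReal⁻¹ + q₁.toReal⁻¹)),
          div_pos (by linarith) hd, (div_lt_one hd).2 (by linarith), ?_⟩
        generalize p₁.toReal⁻¹ + q₁.toReal⁻¹ = m₁ at *
        generalize p₀.toReal⁻¹ + q₀.toReal⁻¹ = m₀ at *
        field_simp
        ring
    have hτ' : 0 < 1 - τ := by linarith
    set a := (1 - τ) * p₀.toReal⁻¹ + τ * p₁.toReal⁻¹ with ha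
    set b := (1 - τ) * q₀.toReal⁻¹ + τ * q₁.toReal⁻¹ with hb
    have hab : a + b = 2 * t.toReal⁻¹ := by rw [← hτ, ha, hb]; ring
    have hba : b < a := by
      have h1 : (1 - τ) * q₀.toReal⁻¹ < (1 - τ) * p₀.toReal⁻¹ := by gcongr
      have h2 : τ * q₁.toReal⁻¹ ≤ τ * p₁.toReal⁻¹ := by gcongr
      rw [ha, hb]
      linarith
    have hb0 : 0 ≤ b := by positivity
    have ha1 : a ≤ 1 := by
      rw [ha]
      nlinarith
    obtain ⟨s, hs, hsb⟩ := exists_toReal_inv_eq hb0 (by linarith)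
    obtain ⟨r, hr, hrc⟩ := exists_toReal_inv_eq (b := (t.toReal⁻¹ + a) / 2) (by linarith)
      (by linarith)
    have hrpos : 0 < r.toReal := by
      rw [← inv_pos, hrc]
      linarith
    refine ⟨r, s, hr, lt_of_toReal_inv_lt ht (by rw [hrc]; linarith),
      lt_of_toReal_inv_lt hs (by rw [hsb]; linarith),
      interp p₀ q₀ p₁ q₁ r s τ hp₀ hp₁ hq₀ hq₁ hs hr ?_ hτ0 hτ1 hsb ?_ h₀ h₁⟩
    · rintro rfl
      simp at hrpos
    · rw [← ha, ← inv_mul_lt_iff₀ hrpos, mul_one, hrc]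
      linarith
  -- two estimates with disjoint ranges of exponents join up
  have hchain : ∀ p q p₁ q₁, 1 ≤ p → p < q → q < p₁ → p₁ < q₁ → R p q → R p₁ q₁ → R p q₁ := by
    intro p q p₁ q₁ hp hpq hqp hpq₁ h h₁
    have hq : 1 ≤ q := hp.trans hpq.le
    have hp₁ : 1 ≤ p₁ := hq.trans hqp.le
    set A : Set ℝ≥0∞ := {s | q ≤ s ∧ s ≤ q₁ ∧ R p s} with hA
    have hqA : q ∈ A := ⟨le_rfl, (hqp.trans hpq₁).le, h⟩
    have hqs : q ≤ sSup A := le_sSup hqA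
    rcases le_or_gt (sSup A) p₁ with hle | hgt
    · exfalso
      have hs1 : 1 ≤ sSup A := hq.trans hqs
      obtain ⟨r, s, hr, hrσ, hσs, hrs⟩ := hlocal p q p₁ q₁ (sSup A) hp hpq hp₁ hpq₁.le hs1 h
        (Or.inl h₁) (Or.inr ⟨by
          have := toReal_inv_lt hp₁ hpq₁
          have := toReal_inv_anti hs1 hle
          linarith, by
          have := toReal_inv_lt hp hpq
          have := toReal_inv_anti hq hqs
          linarith⟩)
      obtain ⟨a, haA, hra⟩ := lt_sSup_iff.1 hrσ
      have haσ : a ≤ sSup A := le_sSup haA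
      have h2 : R p s := trans p a s hp (hpq.le.trans haA.1) (haσ.trans hσs.le) haA.2.2
        (mono r s a s hr hra.le (haσ.trans hσs.le) le_rfl hrs)
      have hσm : sSup A < min s q₁ := lt_min hσs (hle.trans_lt hpq₁)
      have hm : min s q₁ ∈ A := ⟨hqs.trans hσm.le, min_le_right _ _,
        mono p s p _ hp le_rfl (hpq.le.trans (hqs.trans hσm.le)) (min_le_left _ _) h2⟩
      exact absurd (le_sSup hm) (not_le.2 hσm)
    · obtain ⟨a, haA, hpa⟩ := lt_sSup_iff.1 hgt
      exact trans p a q₁ hp (hpq.le.trans haA.1) haA.2.1 haA.2.2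
        (mono p₁ q₁ a q₁ hp₁ hpa.le haA.2.1 le_rfl h₁)
  set J : Set ℝ≥0∞ := {s | ∃ p q, 1 ≤ p ∧ p < q ∧ R p q ∧ p ≤ s ∧ s ≤ q} with hJ
  have hJ1 : J ⊆ Set.Icc 1 ∞ := fun s ⟨p, q, hp, _, _, hps, _⟩ => ⟨hp.trans hps, le_top⟩
  have hJR : ∀ p q, 1 ≤ p → p < q → (R p q ↔ p ∈ J ∧ q ∈ J) := by
    intro p q hp hpq
    refine ⟨fun h => ⟨⟨p, q, hp, hpq, h, le_rfl, hpq.le⟩, ⟨p, q, hp, hpq, h, hpq.le, le_rfl⟩⟩, ?_⟩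
    rintro ⟨⟨a, b, ha, hab, h, hap, hpb⟩, ⟨a', b', ha', hab', h', haq, hqb⟩⟩
    rcases le_or_gt q b with hqb2 | hbq
    · exact mono a b p q ha hap hpq.le hqb2 h
    rcases le_or_gt a' b with hab2 | hba
    · rcases le_or_gt a' p with h1 | h1
      · exact mono a' b' p q ha' h1 hpq.le hqb h'
      · exact trans p a' q hp h1.le haq (mono a b p a' ha hap h1.le hab2 h)
          (mono a' b' a' q ha' le_rfl haq hqb h')
    · exact mono a b' p q ha hap hpq.le hqb (hchain a b a' b' ha hab hba hab' h h')
  have hJB : J ⊆ B := fun s ⟨p, q, hp, _, h, hps, hsq⟩ =>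
    self s (hp.trans hps) (mono p q s s hp hps le_rfl hsq h)
  have hIcc : Set.Icc p₀ q₀ ⊆ J := fun s hs => ⟨p₀, q₀, hp₀, hpq₀, h₀, hs.1, hs.2⟩
  have hJord : J.OrdConnected := by
    refine ⟨fun p hp q hq s hs => ?_⟩
    rcases eq_or_lt_of_le (hs.1.trans hs.2) with rfl | hpq
    · rwa [← le_antisymm hs.1 hs.2]
    · exact ⟨p, q, (hJ1 hp).1, hpq, (hJR p q (hJ1 hp).1 hpq).2 ⟨hp, hq⟩, hs.1, hs.2⟩
  have hBJ : ∀ b ∈ B, ∀ t, (b < t ∧ t < p₀ ∨ p₀ < t ∧ t < b) → t ∈ J := by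
    intro b hb t ht
    have hb1 := hB b hb
    have hfin : (∃ r s, 1 ≤ r ∧ r < t ∧ t < s ∧ R r s) → t ∈ J := fun ⟨r, s, hr, hrt, hts, h⟩ =>
      ⟨r, s, hr, hrt.trans hts, h, hrt.le, hts.le⟩
    have i0 := toReal_inv_lt hp₀ hpq₀
    rcases ht with ⟨h1, h2⟩ | ⟨h1, h2⟩
    · have ht1 : 1 ≤ t := hb1.trans h1.le
      refine hfin (hlocal p₀ q₀ b b t hp₀ hpq₀ hb1 le_rfl ht1 h₀ (Or.inr ⟨rfl, hb⟩) (Or.inl ?_))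
      have i1 := toReal_inv_lt ht1 h2
      have i2 := toReal_inv_lt hb1 h1
      constructor <;> linarith
    · have ht1 : 1 ≤ t := hp₀.trans h1.le
      rcases le_or_gt t q₀ with h3 | h3
      · exact hIcc ⟨h1.le, h3⟩
      refine hfin (hlocal p₀ q₀ b b t hp₀ hpq₀ hb1 le_rfl ht1 h₀ (Or.inr ⟨rfl, hb⟩) (Or.inr ?_))
      have i1 := toReal_inv_lt (hp₀.trans hpq₀.le) h3
      have i2 := toReal_inv_lt ht1 h2
      constructor <;> linarith
  have hp₀J : p₀ ∈ J := hIcc ⟨le_rfl, hpq₀.le⟩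
  refine ⟨J, ⟨hJ1, hJR⟩, ?_, hJord, hIcc, hJB, ?_, ?_⟩
  · rintro J' ⟨hJ'1, hJ'R⟩
    -- any two such sets contain `p₀ < q₀`, one of which differs from a given exponent
    have hsub : ∀ J₁ J₂ : Set ℝ≥0∞, J₁ ⊆ Set.Icc 1 ∞ →
        (∀ p q, 1 ≤ p → p < q → (R p q ↔ p ∈ J₁ ∧ q ∈ J₁)) →
        (∀ p q, 1 ≤ p → p < q → (R p q ↔ p ∈ J₂ ∧ q ∈ J₂)) → J₁ ⊆ J₂ := by
      intro J₁ J₂ h1 hR1 hR2 s hs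
      have hs1 := (h1 hs).1
      have h4 := (hR1 p₀ q₀ hp₀ hpq₀).1 h₀
      rcases lt_or_ge s q₀ with h | h
      · exact ((hR2 s q₀ hs1 h).1 ((hR1 s q₀ hs1 h).2 ⟨hs, h4.2⟩)).1
      · have h5 := hpq₀.trans_le h
        exact ((hR2 p₀ s hp₀ h5).1 ((hR1 p₀ s hp₀ h5).2 ⟨h4.1, hs⟩)).2
    exact Set.Subset.antisymm (hsub J' J hJ'1 hJ'R hJR) (hsub J J' hJ1 hJR hJ'R)
  · refine ⟨fun p hp q hq s hs => ?_⟩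
    rcases eq_or_lt_of_le hs.1 with rfl | h1
    · exact hp
    rcases eq_or_lt_of_le hs.2 with rfl | h2
    · exact hq
    rcases lt_trichotomy s p₀ with h | rfl | h
    · exact hJB (hBJ p hp s (Or.inl ⟨h1, h⟩))
    · exact hJB hp₀J
    · exact hJB (hBJ q hq s (Or.inr ⟨h, h2⟩))
  · have hInf : sInf J = sInf B := by
      refine le_antisymm (le_sInf fun b hb => ?_) (sInf_le_sInf hJB)
      rcases le_or_gt p₀ b with h | h
      · exact (sInf_le hp₀J).trans h
      · refine le_of_forall_gt_imp_ge_of_dense fun t ht => ?_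
        rcases lt_or_ge t p₀ with h' | h'
        · exact sInf_le (hBJ b hb t (Or.inl ⟨ht, h'⟩))
        · exact (sInf_le hp₀J).trans h'
    have hSup : sSup J = sSup B := by
      refine le_antisymm (sSup_le_sSup hJB) (sSup_le fun b hb => ?_)
      rcases le_or_gt b p₀ with h | h
      · exact h.trans (le_sSup hp₀J)
      · refine le_of_forall_lt_imp_le_of_dense fun t ht => ?_
        rcases lt_or_ge p₀ t with h' | h'
        · exact le_sSup (hBJ b hb t (Or.inr ⟨h', ht⟩))
        · exact h'.trans (le_sSup hp₀J)
    rw [openHull, openHull, hInf, hSup]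

end OffDiagBalls

theorem mainTheorem6 {𝕜 : Type*} [RCLike 𝕜]
    {X : Type*} [MetricSpace X] [MeasurableSpace X] [BorelSpace X]
    (μ : MeasureTheory.Measure X) (hμ : OffDiagBalls.Doubling μ)
    {E : Type*} [NormedAddCommGroup E] [NormedSpace 𝕜 E] [CompleteSpace E]
    (F : OffDiagBalls.FunctionSpace 𝕜 μ E)
    (T : ℝ → E →L[𝕜] E)
    (hT : ∀ s t : ℝ, 0 < s → 0 < t → (T s).comp (T t) = T (s + t))
    (hcont : ∀ t : ℝ, 0 < t → OffDiagBalls.BallContinuous F (T t))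
    (p₀ q₀ : ENNReal) (hp₀ : 1 ≤ p₀) (hpq₀ : p₀ < q₀)
    (hoff : OffDiagBalls.OffDiag F T p₀ q₀) :
    ∃ J : Set ENNReal,
      OffDiagBalls.CharacterizesOffDiag F T J ∧
      (∀ J' : Set ENNReal, OffDiagBalls.CharacterizesOffDiag F T J' → J' = J) ∧
      J.OrdConnected ∧
      Set.Icc p₀ q₀ ⊆ J ∧
      J ⊆ OffDiagBalls.boundedExponents F T ∧
      (OffDiagBalls.boundedExponents F T).OrdConnected ∧
      OffDiagBalls.openHull J = OffDiagBalls.openHull (OffDiagBalls.boundedExponents F T) := by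
  rcases hμ.eq_zero_or with rfl | ⟨D, hD⟩
  · -- for the zero measure all the estimates hold trivially
    have hall : ∀ p q, OffDiagBalls.OffDiag F T p q := fun p q =>
      ⟨1, 1, 1, 1, one_pos, one_pos, one_pos, one_pos, fun t _ x r _ f _ => by
        simp [OffDiagBalls.ballAvg, OffDiagBalls.annulusAvg, OffDiagBalls.avgNorm]⟩
    have hbdd : ∀ p, 1 ≤ p → p ∈ OffDiagBalls.boundedExponents F T := fun p hp =>
      ⟨hp, 1, fun t _ f _ => by simp⟩
    exact OffDiagBalls.exists_interval (OffDiagBalls.OffDiag F T)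
      (OffDiagBalls.boundedExponents F T) (fun p hp => hp.1) (fun _ _ _ _ _ _ _ _ _ => hall _ _)
      (fun _ _ _ _ _ _ _ _ => hall _ _) (fun p hp _ => hbdd p hp)
      (fun _ _ _ _ _ _ _ _ _ _ _ _ _ _ _ _ _ _ _ _ => hall _ _) p₀ q₀ hp₀ hpq₀ hoff
  · have toLoc : ∀ {p q}, 1 ≤ p → 1 ≤ q → OffDiagBalls.OffDiag F T p q →
        OffDiagBalls.Loc F T p q := fun hp hq h => h.loc hD hp hq
    refine OffDiagBalls.exists_interval (OffDiagBalls.OffDiag F T)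
      (OffDiagBalls.boundedExponents F T) (fun p hp => hp.1) ?_ ?_ ?_ ?_ p₀ q₀ hp₀ hpq₀ hoff
    · intro p q p' q' hp hpp hpq hqq h
      have hp' := hp.trans hpp
      exact ((toLoc hp (hp'.trans (hpq.trans hqq)) h).mono hD hp hpp hpq hqq).offDiag hD
        (hp'.trans hpq)
    · intro p q r hp hpq hqr h₁ h₂
      have hq := hp.trans hpq
      exact ((toLoc hp hq h₁).trans hD hT hcont hp hpq hqr (toLoc hq (hq.trans hqr) h₂)).offDiag hD
        (hq.trans hqr)
    · intro p hp h
      exact (toLoc hp hp h).mem_boundedExponents hD hcont hp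
    · intro p₀ q₀ p₁ q₁ r s τ hp₀ hp₁ hq₀ hq₁ hs hr hr' hτ0 hτ1 hτ hloss h₀ h₁
      have h₁' : OffDiagBalls.LocEst F T p₁ q₁ 0 0 := by
        rcases h₁ with h₁ | ⟨rfl, h₁⟩
        · exact (toLoc hp₁ hq₁ h₁).1
        · exact OffDiagBalls.locEst_of_mem_boundedExponents h₁
      exact ((toLoc hp₀ hq₀ h₀).interpolation hD h₁' hp₀ hp₁ hq₀ hq₁ hs hr hr' hτ0 hτ1 hτ
        hloss).offDiag hD hs
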